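/- **Conventions.** A modulus of continuity is a continuous increasing function $\rho:[0,1]\to[0,\infty)$ with $\rho(0)=0$ and $\rho(h)>0$ for $h>0$. For $f:[0,1]\to\mathbb{R}$ put $|f|_\rho=\sup_{u,v\in[0,1]}|f(u)-f(v)|/\rho(|u-v|)$, where $0/0=0$ and $x/0=\infty$ for $x>0$ (the same convention is used for quotients by $\rho_0$ below). $C^\rho$ is the space of continuous $f:[0,1]\to\mathbb{R}$ with $|f|_\rho<\infty$, normed by $\|f\|_\rho=\|f\|_\infty+|f|_\rho$, and $C^\rho_0$ is the subspace of those $f\in C^\rho$ with $\lim_{\delta\downarrow0}\sup_{0<|u-v|<\delta}|f(u)-f(v)|/\rho(|u-v|)=0$. We write $\rho\gg\rho_0$ if $\rho_0(h)/\rho(h)\to0$ as $h\downarrow0$ (that is, $\rho(h)/\rho_0(h)\to\infty$). For $\tau\in\mathbb{R}$ and real random variables, $X_n\Rightarrow_\tau X$ means that $P(X_n>t)\to P(X>t)$ for every $t>\tau$ that is a continuity point of the distribution function of $X$. $\Rightarrow_{\mathrm{fidi}}$ denotes weak convergence of all finite dimensional marginals. **Theorem.** Let $W_n$ be a sequence of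 stochastic processes with paths in $C[0,1]$ (possibly on different probability spaces), and let $\rho_0:[0,1]\to[0,\infty)$ be an increasing function with $\rho_0(0)=0$. Suppose there is $C>0$ such that for every $t>C$ there are $\kappa(t)>1$ and $K(t)>0$ with $$P\left(\frac{|W_n(u)-W_n(v)|}{\rho_0(|u-v|)}>t\right)\le K(t)\,|u-v|^{\kappa(t)},\qquad u,v\in[0,1],\ n\in\mathbb{N}, \tag{T}$$ and that there are $p>0$ and $\widetilde K>0$ with $$\rho_0(zh)\le\widetilde K z^p\rho_0(h),\qquad h,z\in[0,1]. \tag{R}$$ 1. For every $t>C$, $$\sup_n P\left(\sup_{u,v\in[0,1],\,|u-v|\le h}\frac{|W_n(u)-W_n(v)|}{\rho_0(|u-v|)}>t\right)\longrightarrow0\quad\text{as }h\downarrow0.$$ 2. For every modulus of continuity $\rho\gg\rho_0$ the sequence $|W_n|_\rho$ is stochastically bounded. 3. Suppose in addition that $W_n\Rightarrow_{\mathrm{fidi}}W$ for some real-valued stochastic process $W$ on $[0,1]$. Then $W$ has a modification with paths in $C[0,1]$, and for every such modification, again denoted by $W$ (in particular for $W$ itself if its paths are continuous), the following holds. - For every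 modulus of continuity $\rho\gg\rho_0$, almost surely $W_n\in C^\rho_0$ for all $n$ and $W\in C^\rho_0$, and $W_n\Rightarrow W$ weakly in $C^\rho_0$. - For every modulus of continuity $\rho$ with $\rho(h)/\rho_0(h)\to1$ as $h\downarrow0$, the seminorms $|W_n|_\rho$ and $|W|_\rho$ are almost surely finite and $|W_n|_\rho\Rightarrow_C|W|_\rho$. -/

import Mathlib

open Filter Topology MeasureTheory ProbabilityTheory
open scoped ENNReal unitInterval

noncomputable section

/-- A modulus of continuity on `[0,1]`: continuous, increasing (in the weak sense), zero at `0` and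
positive elsewhere. Only the values on `[0,1]` matter. -/
structure IsModulus (ρ : ℝ → ℝ) : Prop where
  continuousOn : ContinuousOn ρ (Set.Icc 0 1)
  monotoneOn : MonotoneOn ρ (Set.Icc 0 1)
  map_zero : ρ 0 = 0
  pos : ∀ h ∈ Set.Ioc (0 : ℝ) 1, 0 < ρ h

/-- `ρ ≫ ρ'`, i.e. `ρ'(h) / ρ(h) → 0` as `h ↓ 0`. -/
def MuchLarger (ρ ρ' : ℝ → ℝ) : Prop :=
  Tendsto (fun h => ρ' h / ρ h) (𝓝[>] 0) (𝓝 0)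

/-- The weighted increment `|f(u) - f(v)| / ρ(|u - v|)` in `[0,∞]`, where `0 / 0 = 0` and
`x / 0 = ∞` for `x > 0`. In particular the value is `0` when `u = v`. -/
def weightedIncr (ρ : ℝ → ℝ) (f : I → ℝ) (u v : I) : ℝ≥0∞ :=
  ‖f u - f v‖ₑ / ENNReal.ofReal (ρ |(u : ℝ) - v|)

/-- The local Hölder modulus: the supremum of `|f(u) - f(v)| / ρ(|u - v|)` over `|u - v| ≤ h`. -/
def localHolder (ρ : ℝ → ℝ) (h : ℝ) (f : I → ℝ) : ℝ≥0∞ :=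
  ⨆ (u : I) (v : I) (_ : |(u : ℝ) - v| ≤ h), weightedIncr ρ f u v

/-- The Hölder-type seminorm `|f|_ρ`, with values in `[0,∞]`. -/
def holderSeminorm (ρ : ℝ → ℝ) (f : I → ℝ) : ℝ≥0∞ :=
  ⨆ (u : I) (v : I), weightedIncr ρ f u v

theorem weightedIncr_zero (ρ : ℝ → ℝ) (u v : I) : weightedIncr ρ (fun _ => 0) u v = 0 := by
  simp [weightedIncr]

theorem weightedIncr_add (ρ : ℝ → ℝ) (f g : I → ℝ) (u v : I) :
    weightedIncr ρ (fun x => f x + g x) u v ≤ weightedIncr ρ f u v + weightedIncr ρ g u v := by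
  unfold weightedIncr
  rw [← ENNReal.add_div]
  gcongr
  rw [show f u + g u - (f v + g v) = (f u - f v) + (g u - g v) by ring]
  exact enorm_add_le _ _

theorem weightedIncr_smul (ρ : ℝ → ℝ) (c : ℝ) (f : I → ℝ) (u v : I) :
    weightedIncr ρ (fun x => c * f x) u v = ‖c‖ₑ * weightedIncr ρ f u v := by
  unfold weightedIncr
  rw [← mul_sub, enorm_mul, mul_div_assoc]

theorem localHolder_zero (ρ : ℝ → ℝ) (h : ℝ) : localHolder ρ h (fun _ => 0) = 0 := by
  simp [localHolder, weightedIncr_zero]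

theorem localHolder_add (ρ : ℝ → ℝ) (h : ℝ) (f g : I → ℝ) :
    localHolder ρ h (fun x => f x + g x) ≤ localHolder ρ h f + localHolder ρ h g := by
  refine iSup_le fun u => iSup_le fun v => iSup_le fun huv => ?_
  refine (weightedIncr_add ρ f g u v).trans (add_le_add ?_ ?_)
  · exact le_iSup_of_le u (le_iSup_of_le v (le_iSup_of_le huv le_rfl))
  · exact le_iSup_of_le u (le_iSup_of_le v (le_iSup_of_le huv le_rfl))

theorem localHolder_smul (ρ : ℝ → ℝ) (h : ℝ) (c : ℝ) (f : I → ℝ) :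
    localHolder ρ h (fun x => c * f x) = ‖c‖ₑ * localHolder ρ h f := by
  simp only [localHolder, weightedIncr_smul, ENNReal.mul_iSup]

theorem holderSeminorm_zero (ρ : ℝ → ℝ) : holderSeminorm ρ (fun _ => 0) = 0 := by
  simp [holderSeminorm, weightedIncr_zero]

theorem holderSeminorm_add (ρ : ℝ → ℝ) (f g : I → ℝ) :
    holderSeminorm ρ (fun x => f x + g x) ≤ holderSeminorm ρ f + holderSeminorm ρ g := by
  refine iSup_le fun u => iSup_le fun v => ?_
  refine (weightedIncr_add ρ f g u v).trans (add_le_add ?_ ?_)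
  · exact le_iSup_of_le u (le_iSup_of_le v le_rfl)
  · exact le_iSup_of_le u (le_iSup_of_le v le_rfl)

theorem holderSeminorm_smul (ρ : ℝ → ℝ) (c : ℝ) (f : I → ℝ) :
    holderSeminorm ρ (fun x => c * f x) = ‖c‖ₑ * holderSeminorm ρ f := by
  simp only [holderSeminorm, weightedIncr_smul, ENNReal.mul_iSup]

/-- The continuous functions on `[0,1]` with finite Hölder-type seminorm. -/
def holderSubmodule (ρ : ℝ → ℝ) : Submodule ℝ C(I, ℝ) where
  carrier := {f | holderSeminorm ρ f ≠ ∞}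
  zero_mem' := by
    have h : holderSeminorm ρ (fun _ => 0) ≠ ∞ := by simp [holderSeminorm_zero]
    exact h
  add_mem' := by
    intro f g hf hg
    exact ne_top_of_le_ne_top (ENNReal.add_ne_top.2 ⟨hf, hg⟩) (holderSeminorm_add ρ f g)
  smul_mem' := by
    intro c f hf
    have h : holderSeminorm ρ (fun x => c * f x) ≠ ∞ := by
      rw [holderSeminorm_smul]
      exact ENNReal.mul_ne_top enorm_ne_top hf
    exact h

/-- The space `C^ρ`. It is a type of its own, so that it carries the norm below and not the
supremum norm inherited from `C[0,1]`. -/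
def HolderSpace (ρ : ℝ → ℝ) : Type := holderSubmodule ρ

instance (ρ : ℝ → ℝ) : AddCommGroup (HolderSpace ρ) :=
  inferInstanceAs (AddCommGroup (holderSubmodule ρ))

instance (ρ : ℝ → ℝ) : Module ℝ (HolderSpace ρ) :=
  inferInstanceAs (Module ℝ (holderSubmodule ρ))

/-- The underlying continuous function of an element of `C^ρ`. -/
def HolderSpace.toC {ρ : ℝ → ℝ} (f : HolderSpace ρ) : C(I, ℝ) := Subtype.val f

/-- The norm `‖f‖_ρ = ‖f‖_∞ + |f|_ρ` on `C^ρ`. -/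
def holderNorm (ρ : ℝ → ℝ) : AddGroupNorm (HolderSpace ρ) where
  toFun f := ‖f.toC‖ + (holderSeminorm ρ f.toC).toReal
  map_zero' := by
    have h1 : (0 : HolderSpace ρ).toC = 0 := rfl
    have h2 : holderSeminorm ρ ((0 : C(I, ℝ)) : I → ℝ) = 0 := holderSeminorm_zero ρ
    rw [h1, h2]
    simp
  add_le' := by
    intro f g
    have h1 : (f + g).toC = f.toC + g.toC := rfl
    have h2 := ENNReal.toReal_mono (ENNReal.add_ne_top.2 ⟨f.2, g.2⟩)
      (holderSeminorm_add ρ f.toC g.toC)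
    rw [ENNReal.toReal_add f.2 g.2] at h2
    have h3 := norm_add_le f.toC g.toC
    rw [h1]
    have h4 : (holderSeminorm ρ (f.toC + g.toC : C(I, ℝ))).toReal
        ≤ (holderSeminorm ρ f.toC).toReal + (holderSeminorm ρ g.toC).toReal := h2
    linarith
  neg' := by
    intro f
    have h1 : (-f).toC = -f.toC := rfl
    have h2 : holderSeminorm ρ (-f.toC : C(I, ℝ)) = holderSeminorm ρ f.toC := by
      have h := holderSeminorm_smul ρ (-1) f.toC
      simp only [neg_mul, one_mul, enorm_neg, enorm_one] at h
      exact h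
    rw [h1, h2, norm_neg]
  eq_zero_of_map_eq_zero' := by
    intro f hf
    have h1 : ‖f.toC‖ = 0 := by
      have h2 := norm_nonneg f.toC
      have h3 := ENNReal.toReal_nonneg (a := holderSeminorm ρ f.toC)
      linarith
    exact Subtype.ext (norm_eq_zero.1 h1)

instance (ρ : ℝ → ℝ) : NormedAddCommGroup (HolderSpace ρ) :=
  (holderNorm ρ).toNormedAddCommGroup

instance (ρ : ℝ → ℝ) : MeasurableSpace (HolderSpace ρ) := borel _

instance (ρ : ℝ → ℝ) : BorelSpace (HolderSpace ρ) := ⟨rfl⟩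

/-- The subspace `C^ρ_0` of `C^ρ`, with the norm of `C^ρ`: functions whose local Hölder modulus
vanishes as `δ ↓ 0`. (The supremum over `0 < |u - v| < δ` and the one over `|u - v| ≤ δ` have the
same limit.) -/
def holderZero (ρ : ℝ → ℝ) : Submodule ℝ (HolderSpace ρ) where
  carrier := {f | Tendsto (fun δ => localHolder ρ δ f.toC) (𝓝[>] 0) (𝓝 0)}
  zero_mem' := by
    have h : Tendsto (fun δ => localHolder ρ δ (fun _ => 0)) (𝓝[>] 0) (𝓝 0) := by
      simp [localHolder_zero]
    exact h
  add_mem' := by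
    intro f g hf hg
    have h := Tendsto.add hf hg
    rw [add_zero] at h
    exact tendsto_of_tendsto_of_tendsto_of_le_of_le tendsto_const_nhds h
      (fun _ => bot_le) (fun δ => localHolder_add ρ δ f.toC g.toC)
  smul_mem' := by
    intro c f hf
    have h := ENNReal.Tendsto.const_mul (a := ‖c‖ₑ) hf (Or.inr enorm_ne_top)
    rw [mul_zero] at h
    have h' : Tendsto (fun δ => localHolder ρ δ (fun x => c * f.toC x)) (𝓝[>] 0) (𝓝 0) := by
      simpa only [localHolder_smul] using h
    exact h'

/-- A stochastic process on `[0,1]` all of whose paths are continuous. -/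
structure IsContinuousProcess {Ω : Type*} [MeasurableSpace Ω] (W : I → Ω → ℝ) : Prop where
  measurable : ∀ u, Measurable (W u)
  continuous : ∀ ω, Continuous fun u => W u ω

/-- Weak convergence `W_n ⇒_fidi W` of all finite dimensional marginals. -/
def TendstoFidi {Ω : ℕ → Type*} [∀ n, MeasurableSpace (Ω n)] (P : ∀ n, Measure (Ω n))
    [∀ n, IsProbabilityMeasure (P n)] {Ω' : Type*} [MeasurableSpace Ω'] (P' : Measure Ω')
    [IsProbabilityMeasure P'] (W : ∀ n, I → Ω n → ℝ) (W' : I → Ω' → ℝ) : Prop :=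
  ∀ s : Finset I, TendstoInDistribution (fun n ω (u : s) => W n u ω) atTop
    (fun ω (u : s) => W' u ω) P P'

/-- Weak convergence `W_n ⇒ W` in `C^ρ_0`: almost surely the paths of the processes lie in
`C^ρ_0`, they define random elements of this normed space, and these converge in distribution. -/
def TendstoHolderZero (ρ : ℝ → ℝ) {Ω : ℕ → Type*} [∀ n, MeasurableSpace (Ω n)]
    (P : ∀ n, Measure (Ω n)) [∀ n, IsProbabilityMeasure (P n)] {Ω' : Type*} [MeasurableSpace Ω']
    (P' : Measure Ω') [IsProbabilityMeasure P'] (W : ∀ n, I → Ω n → ℝ) (W' : I → Ω' → ℝ) : Prop :=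
  ∃ (X : ∀ n, Ω n → holderZero ρ) (X' : Ω' → holderZero ρ),
    (∀ n, ∀ᵐ ω ∂(P n), ∀ u, (X n ω).1.toC u = W n u ω) ∧
    (∀ᵐ ω ∂P', ∀ u, (X' ω).1.toC u = W' u ω) ∧
    TendstoInDistribution X atTop X' P P'

/-- Weak convergence `X_n ⇒_τ X` beyond the threshold `τ`: `P(X_n > t) → P(X > t)` at every `t > τ`
at which the distribution function of `X` is continuous. -/
def TendstoBeyond (τ : ℝ) {Ω : ℕ → Type*} [∀ n, MeasurableSpace (Ω n)] (P : ∀ n, Measure (Ω n))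
    {Ω' : Type*} [MeasurableSpace Ω'] (P' : Measure Ω') (X : ∀ n, Ω n → ℝ) (X' : Ω' → ℝ) : Prop :=
  ∀ t, τ < t → ContinuousAt (fun s => P' {ω | X' ω ≤ s}) t →
    Tendsto (fun n => P n {ω | t < X n ω}) atTop (𝓝 (P' {ω | t < X' ω}))

end

/-- An increasing function on `[0,1]` that vanishes at `0` and scales at least like a power. -/
structure PowerGauge (ρ₀ : ℝ → ℝ) (p K : ℝ) : Prop where
  nonneg : ∀ h ∈ Set.Icc (0 : ℝ) 1, 0 ≤ ρ₀ h
  mono : MonotoneOn ρ₀ (Set.Icc 0 1)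
  map_zero : ρ₀ 0 = 0
  p_pos : 0 < p
  K_pos : 0 < K
  scale : ∀ h ∈ Set.Icc (0 : ℝ) 1, ∀ z ∈ Set.Icc (0 : ℝ) 1, ρ₀ (z * h) ≤ K * z ^ p * ρ₀ h

theorem abs_sub_mem_Icc (u v : I) : |(u : ℝ) - v| ∈ Set.Icc (0 : ℝ) 1 :=
  ⟨abs_nonneg _, abs_sub_le_iff.2 ⟨by linarith [u.2.2, v.2.1], by linarith [u.2.1, v.2.2]⟩⟩

theorem PowerGauge.le_rpow {ρ₀ : ℝ → ℝ} {p K : ℝ} (h : PowerGauge ρ₀ p K) {z : ℝ}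
    (hz : z ∈ Set.Icc (0 : ℝ) 1) : ρ₀ z ≤ K * ρ₀ 1 * z ^ p := by
  have := h.scale 1 (by simp) z hz
  rw [mul_one] at this
  linarith [this]

/-- The dyadic point `a / 2 ^ m` of the unit interval, truncated at `1`. -/
noncomputable def dyadicPt (m a : ℕ) : I := Set.projIcc 0 1 zero_le_one ((a : ℝ) / 2 ^ m)

theorem coe_dyadicPt {m a : ℕ} (h : a ≤ 2 ^ m) : (dyadicPt m a : ℝ) = a / 2 ^ m := by
  have h' : (a : ℝ) ≤ 2 ^ m := by exact_mod_cast h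
  have : (a : ℝ) / 2 ^ m ∈ Set.Icc (0 : ℝ) 1 :=
    ⟨by positivity, by rw [div_le_one (by positivity)]; exact h'⟩
  rw [dyadicPt, Set.projIcc_of_mem _ this]

theorem dyadicPt_succ (m a : ℕ) : dyadicPt (m + 1) (2 * a) = dyadicPt m a := by
  unfold dyadicPt
  congr 1
  push_cast
  rw [pow_succ]
  field_simp

theorem abs_dyadicPt_sub_le (m a b : ℕ) :
    |(dyadicPt m a : ℝ) - dyadicPt m b| ≤ |(a : ℝ) - b| / 2 ^ m := by
  unfold dyadicPt
  rw [Set.coe_projIcc, Set.coe_projIcc]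
  refine (abs_max_sub_max_le_max _ _ _ _).trans ?_
  rw [sub_self, abs_zero, max_eq_right (abs_nonneg _)]
  refine (abs_min_sub_min_le_max _ _ _ _).trans ?_
  rw [sub_self, abs_zero, max_eq_right (abs_nonneg _), ← sub_div, abs_div,
    abs_of_pos (a := (2 : ℝ) ^ m) (by positivity)]

/-- Increments of `f` between dyadic points of level `m ≥ j` at most `2 ^ N` grid steps apart are
controlled by `s * ρ₀`. -/
def GridControl (ρ₀ : ℝ → ℝ) (s : ℝ) (N j : ℕ) (f : I → ℝ) : Prop :=
  ∀ m, j ≤ m → ∀ a < 2 ^ m, ∀ d < 2 ^ N, |f (dyadicPt m a) - f (dyadicPt m (a + d + 1))| ≤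
    s * ρ₀ |(dyadicPt m a : ℝ) - dyadicPt m (a + d + 1)|

theorem GridControl.le {ρ₀ : ℝ → ℝ} {s : ℝ} {N j : ℕ} {f : I → ℝ} (h : GridControl ρ₀ s N j f)
    {m a b : ℕ} (hm : j ≤ m) (hab : a < b) (hb : b ≤ 2 ^ m) (hd : b ≤ a + 2 ^ N) :
    |f (dyadicPt m a) - f (dyadicPt m b)| ≤ s * ρ₀ (((b : ℝ) - a) / 2 ^ m) := by
  have h1 := h m hm a (by omega) (b - a - 1) (by omega)
  rw [show a + (b - a - 1) + 1 = b by omega, coe_dyadicPt hb, coe_dyadicPt (hab.le.trans hb)] at h1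
  have : (a : ℝ) < b := by exact_mod_cast hab
  rwa [abs_sub_comm ((a : ℝ) / _), ← sub_div,
    abs_of_nonneg (div_nonneg (by linarith) (by positivity) : 0 ≤ ((b : ℝ) - a) / 2 ^ m)] at h1

theorem half_pow_mem_Icc (m : ℕ) : ((1 : ℝ) / 2) ^ m ∈ Set.Icc (0 : ℝ) 1 :=
  ⟨by positivity, pow_le_one₀ (by norm_num) (by norm_num)⟩

section
variable {ρ₀ : ℝ → ℝ} {p K s : ℝ} {N j : ℕ} {f : I → ℝ}

theorem GridControl.le_succ (h : GridControl ρ₀ s N j f) (hρ : PowerGauge ρ₀ p K) (hs : 0 ≤ s)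
    {m a b : ℕ} (hm : j ≤ m) (hab : a ≤ b) (hb : b ≤ 2 ^ m) (hd : b ≤ a + 1) :
    |f (dyadicPt m a) - f (dyadicPt m b)| ≤ s * ρ₀ ((1 / 2) ^ m) := by
  rcases hab.eq_or_lt with rfl | hab
  · rw [sub_self, abs_zero]
    exact mul_nonneg hs (hρ.nonneg _ (half_pow_mem_Icc m))
  · have hb' : b = a + 1 := by omega
    have := h.le hm hab hb (hd.trans (by have := Nat.one_le_two_pow (n := N); omega))
    rw [hb'] at this ⊢
    push_cast at this
    rwa [add_sub_cancel_left, ← one_div_pow] at this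

/-- The smallest dyadic point of level `m` above `u`. -/
noncomputable def dyadicUp (m : ℕ) (u : I) : I := dyadicPt m ⌈(u : ℝ) * 2 ^ m⌉₊

/-- The largest dyadic point of level `m` below `u`. -/
noncomputable def dyadicDown (m : ℕ) (u : I) : I := dyadicPt m ⌊(u : ℝ) * 2 ^ m⌋₊

theorem ceil_mul_le (m : ℕ) (u : I) : ⌈(u : ℝ) * 2 ^ m⌉₊ ≤ 2 ^ m := by
  rw [Nat.ceil_le]
  push_cast
  exact mul_le_of_le_one_left (by positivity) u.2.2

theorem floor_mul_le (m : ℕ) (u : I) : ⌊(u : ℝ) * 2 ^ m⌋₊ ≤ 2 ^ m :=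
  (Nat.floor_le_ceil _).trans (ceil_mul_le m u)

theorem coe_dyadicUp (m : ℕ) (u : I) : (dyadicUp m u : ℝ) = ⌈(u : ℝ) * 2 ^ m⌉₊ / 2 ^ m :=
  coe_dyadicPt (ceil_mul_le m u)

theorem coe_dyadicDown (m : ℕ) (u : I) : (dyadicDown m u : ℝ) = ⌊(u : ℝ) * 2 ^ m⌋₊ / 2 ^ m :=
  coe_dyadicPt (floor_mul_le m u)

theorem le_dyadicUp (m : ℕ) (u : I) : (u : ℝ) ≤ dyadicUp m u := by
  rw [coe_dyadicUp, le_div_iff₀ (by positivity)]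
  exact Nat.le_ceil _

theorem dyadicUp_lt (m : ℕ) (u : I) : (dyadicUp m u : ℝ) < u + (1 / 2) ^ m := by
  rw [coe_dyadicUp, div_lt_iff₀ (by positivity), add_mul, ← mul_pow]
  have := Nat.ceil_lt_add_one (show 0 ≤ (u : ℝ) * 2 ^ m from mul_nonneg u.2.1 (by positivity))
  norm_num
  exact this

theorem dyadicDown_le (m : ℕ) (u : I) : (dyadicDown m u : ℝ) ≤ u := by
  rw [coe_dyadicDown, div_le_iff₀ (by positivity)]
  exact Nat.floor_le (mul_nonneg u.2.1 (by positivity))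

theorem lt_dyadicDown (m : ℕ) (u : I) : (u : ℝ) - (1 / 2) ^ m < dyadicDown m u := by
  rw [coe_dyadicDown, lt_div_iff₀ (by positivity), sub_mul, ← mul_pow]
  have := Nat.lt_floor_add_one ((u : ℝ) * 2 ^ m)
  norm_num
  linarith

theorem abs_dyadicDown_sub_le (m : ℕ) (u : I) : |(dyadicDown m u : ℝ) - u| ≤ (1 / 2) ^ m :=
  abs_sub_le_iff.2 ⟨by linarith [dyadicDown_le m u, (half_pow_mem_Icc m).1],
    by linarith [lt_dyadicDown m u]⟩

theorem tendsto_half_pow : Tendsto (fun m : ℕ => ((1 : ℝ) / 2) ^ m) atTop (𝓝 0) :=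
  tendsto_pow_atTop_nhds_zero_of_lt_one (by norm_num) (by norm_num)

theorem tendsto_dyadicDown (u : I) : Tendsto (fun m => dyadicDown m u) atTop (𝓝 u) := by
  rw [tendsto_subtype_rng]
  refine tendsto_of_tendsto_of_tendsto_of_le_of_le (g := fun m : ℕ => (u : ℝ) - (1 / 2) ^ m) ?_
    tendsto_const_nhds (fun m => (lt_dyadicDown m u).le) fun m => dyadicDown_le m u
  simpa using tendsto_half_pow.const_sub (u : ℝ)

theorem tendsto_dyadicUp (u : I) : Tendsto (fun m => dyadicUp m u) atTop (𝓝 u) := by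
  rw [tendsto_subtype_rng]
  refine tendsto_of_tendsto_of_tendsto_of_le_of_le (h := fun m : ℕ => (u : ℝ) + (1 / 2) ^ m)
    tendsto_const_nhds ?_ (fun m => le_dyadicUp m u) fun m => (dyadicUp_lt m u).le
  simpa using tendsto_half_pow.const_add (u : ℝ)

theorem GridControl.dyadicUp_succ (h : GridControl ρ₀ s N j f) (hρ : PowerGauge ρ₀ p K)
    (hs : 0 ≤ s) {m : ℕ} (hm : j ≤ m) (u : I) :
    |f (dyadicUp m u) - f (dyadicUp (m + 1) u)| ≤ s * ρ₀ ((1 / 2) ^ (m + 1)) := by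
  have h0 : 0 ≤ (u : ℝ) * 2 ^ m := mul_nonneg u.2.1 (by positivity)
  have e : (u : ℝ) * 2 ^ (m + 1) = 2 * (u * 2 ^ m) := by ring
  rw [dyadicUp, ← dyadicPt_succ, abs_sub_comm]
  refine h.le_succ hρ hs (by omega) ?_ ?_ ?_
  · rw [Nat.ceil_le, e]
    push_cast
    linarith [Nat.le_ceil ((u : ℝ) * 2 ^ m)]
  · rw [pow_succ]
    have := ceil_mul_le m u
    omega
  · have h1 := Nat.ceil_lt_add_one h0
    have h2 := Nat.le_ceil ((u : ℝ) * 2 ^ (m + 1))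
    have : ((2 * ⌈(u : ℝ) * 2 ^ m⌉₊ : ℕ) : ℝ) < ((⌈(u : ℝ) * 2 ^ (m + 1)⌉₊ + 2 : ℕ) : ℝ) := by
      push_cast
      linarith
    have := Nat.cast_lt.1 this
    omega

theorem GridControl.dyadicDown_succ (h : GridControl ρ₀ s N j f) (hρ : PowerGauge ρ₀ p K)
    (hs : 0 ≤ s) {m : ℕ} (hm : j ≤ m) (u : I) :
    |f (dyadicDown m u) - f (dyadicDown (m + 1) u)| ≤ s * ρ₀ ((1 / 2) ^ (m + 1)) := by
  have h0 : 0 ≤ (u : ℝ) * 2 ^ m := mul_nonneg u.2.1 (by positivity)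
  have e : (u : ℝ) * 2 ^ (m + 1) = 2 * (u * 2 ^ m) := by ring
  rw [dyadicDown, ← dyadicPt_succ]
  refine h.le_succ hρ hs (by omega) ?_ (floor_mul_le _ u) ?_
  · refine Nat.le_floor ?_
    rw [e]
    push_cast
    linarith [Nat.floor_le h0]
  · have h1 := Nat.lt_floor_add_one ((u : ℝ) * 2 ^ m)
    have h2 := Nat.floor_le (mul_nonneg u.2.1 (by positivity : (0 : ℝ) ≤ 2 ^ (m + 1)))
    have : ((⌊(u : ℝ) * 2 ^ (m + 1)⌋₊ : ℕ) : ℝ) < ((2 * ⌊(u : ℝ) * 2 ^ m⌋₊ + 2 : ℕ) : ℝ) := by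
      push_cast
      linarith
    have := Nat.cast_lt.1 this
    omega

theorem GridControl.dyadicDown_dyadicUp (h : GridControl ρ₀ s N j f) (hρ : PowerGauge ρ₀ p K)
    (hs : 0 ≤ s) {m : ℕ} (hm : j ≤ m) (u : I) :
    |f (dyadicDown m u) - f (dyadicUp m u)| ≤ s * ρ₀ ((1 / 2) ^ m) :=
  h.le_succ hρ hs hm (Nat.floor_le_ceil _) (ceil_mul_le m u) (Nat.ceil_le_floor_add_one _)

theorem half_rpow_lt_one (hp : 0 < p) : ((1 : ℝ) / 2) ^ p < 1 :=
  Real.rpow_lt_one (by norm_num) (by norm_num) hp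

theorem PowerGauge.half_pow_add_le (hρ : PowerGauge ρ₀ p K) (n i : ℕ) :
    ρ₀ ((1 / 2) ^ (n + i)) ≤ K * ((1 / 2 : ℝ) ^ p) ^ i * ρ₀ ((1 / 2) ^ n) := by
  have := hρ.scale _ (half_pow_mem_Icc n) _ (half_pow_mem_Icc i)
  have e : ((1 / 2 : ℝ) ^ i) ^ p = ((1 / 2 : ℝ) ^ p) ^ i := by
    rw [← Real.rpow_natCast, ← Real.rpow_natCast, ← Real.rpow_mul (by norm_num),
      ← Real.rpow_mul (by norm_num), mul_comm]
  rwa [← pow_add, add_comm i n, e] at this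

theorem abs_sub_le_of_geometric {x : ℕ → ℝ} {B q : ℝ} (hB : 0 ≤ B) (hq0 : 0 ≤ q) (hq1 : q < 1)
    (hx : ∀ k, |x k - x (k + 1)| ≤ B * q ^ k) (k : ℕ) : |x 0 - x k| ≤ B / (1 - q) := by
  have h := dist_le_range_sum_of_dist_le (f := x) (d := fun k => B * q ^ k) k
    fun {i} _ => by rw [Real.dist_eq]; exact hx i
  rw [Real.dist_eq, ← Finset.mul_sum] at h
  refine h.trans ?_
  rw [div_eq_mul_inv, ← tsum_geometric_of_lt_one hq0 hq1]
  exact mul_le_mul_of_nonneg_left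
    ((summable_geometric_of_lt_one hq0 hq1).sum_le_tsum _ fun i _ => pow_nonneg hq0 i) hB

/-- The chaining estimate: control on the dyadic grids gives, up to a constant close to `1`, control
of the increments between the inner dyadic approximations of two arbitrary points. -/
theorem GridControl.dyadicUp_dyadicDown (h : GridControl ρ₀ s N j f) (hρ : PowerGauge ρ₀ p K)
    (hs : 0 ≤ s) (hN : 2 ≤ N) {t : ℝ}
    (ht : s * (1 + 2 * (K * ((1 / 2 : ℝ) ^ p) ^ N / (1 - (1 / 2 : ℝ) ^ p))) ≤ t)
    {u v : I} (huv : (u : ℝ) < v) (hj : (v : ℝ) - u ≤ (1 / 2) ^ j) :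
    ∃ m, ∀ M, m ≤ M → |f (dyadicUp M u) - f (dyadicDown M v)| ≤ t * ρ₀ (v - u) := by
  obtain ⟨n, hn1, hn2⟩ := exists_nat_pow_near_of_lt_one (sub_pos.2 huv)
    (by linarith [u.2.1, v.2.2]) (by norm_num : (0 : ℝ) < 1 / 2) (by norm_num)
  have hjn : j ≤ n := by
    have h1 := (pow_lt_pow_iff_right_of_lt_one₀ (by norm_num : (0 : ℝ) < 1 / 2) (by norm_num)).1
      (hn1.trans_le hj)
    omega
  have hmem : (v : ℝ) - u ∈ Set.Icc (0 : ℝ) 1 := ⟨by linarith, by linarith [u.2.1, v.2.2]⟩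
  have hR0 := hρ.nonneg _ hmem
  set q : ℝ := (1 / 2 : ℝ) ^ p with hq
  have hq0 : 0 < q := Real.rpow_pos_of_pos (by norm_num) _
  have hq1 : q < 1 := half_rpow_lt_one hρ.p_pos
  set B := s * (K * q ^ N * ρ₀ (v - u)) with hB
  have hB0 : 0 ≤ B := mul_nonneg hs (mul_nonneg (mul_nonneg hρ.K_pos.le (by positivity)) hR0)
  have key (k : ℕ) : s * ρ₀ ((1 / 2) ^ (n + N + k + 1)) ≤ B * q ^ k := by
    have h1 := hρ.half_pow_add_le (n + 1) (N + k)
    rw [show n + 1 + (N + k) = n + N + k + 1 by ring] at h1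
    have h2 := hρ.mono (half_pow_mem_Icc (n + 1)) hmem hn1.le
    calc s * ρ₀ ((1 / 2) ^ (n + N + k + 1)) ≤ s * (K * q ^ (N + k) * ρ₀ (v - u)) := by
          refine mul_le_mul_of_nonneg_left (h1.trans ?_) hs
          exact mul_le_mul_of_nonneg_left h2 (mul_nonneg hρ.K_pos.le (by positivity))
      _ = B * q ^ k := by rw [hB, pow_add]; ring
  refine ⟨n + N, fun M hM => ?_⟩
  obtain ⟨k, rfl⟩ := Nat.exists_eq_add_of_le hM
  have hU := abs_sub_le_of_geometric (x := fun k => f (dyadicUp (n + N + k) u)) hB0 hq0.le hq1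
    (fun k => (h.dyadicUp_succ hρ hs (by omega) u).trans (key k)) k
  have hD := abs_sub_le_of_geometric (x := fun k => f (dyadicDown (n + N + k) v)) hB0 hq0.le hq1
    (fun k => (h.dyadicDown_succ hρ hs (by omega) v).trans (key k)) k
  simp only [add_zero] at hU hD
  have hmid : |f (dyadicUp (n + N) u) - f (dyadicDown (n + N) v)| ≤ s * ρ₀ (v - u) := by
    have hu1 := dyadicUp_lt (n + N) u
    have hu0 := le_dyadicUp (n + N) u
    have hv1 := lt_dyadicDown (n + N) v
    have hv0 := dyadicDown_le (n + N) v
    have h4 : 2 * (1 / 2 : ℝ) ^ (n + N) ≤ (1 / 2) ^ (n + 1) := by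
      have : (1 / 2 : ℝ) ^ (n + N) ≤ (1 / 2) ^ (n + 2) :=
        pow_le_pow_of_le_one (by norm_num) (by norm_num) (by omega)
      rw [pow_succ] at this ⊢
      rw [pow_succ] at this
      linarith
    have hlt : (dyadicUp (n + N) u : ℝ) < dyadicDown (n + N) v := by linarith
    have hle : (dyadicDown (n + N) v : ℝ) - dyadicUp (n + N) u ≤ v - u := by linarith
    rw [coe_dyadicUp, coe_dyadicDown] at hlt hle
    have hlt' := (div_lt_div_iff_of_pos_right (by positivity)).1 hlt
    rw [← sub_div] at hle
    have hle2 := hle.trans hn2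
    refine (h.le (m := n + N) (by omega) (by exact_mod_cast hlt') (floor_mul_le _ v) ?_).trans ?_
    · have e : (1 / 2 : ℝ) ^ n * 2 ^ (n + N) = 2 ^ N := by
        rw [pow_add, ← mul_assoc, ← mul_pow]
        norm_num
      rw [div_le_iff₀ (by positivity), e] at hle2
      have : ((⌊(v : ℝ) * 2 ^ (n + N)⌋₊ : ℕ) : ℝ) ≤
          ((⌈(u : ℝ) * 2 ^ (n + N)⌉₊ + 2 ^ N : ℕ) : ℝ) := by
        push_cast
        linarith
      exact_mod_cast this
    · refine mul_le_mul_of_nonneg_left (hρ.mono ⟨?_, hle.trans hmem.2⟩ hmem hle) hs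
      exact div_nonneg (by linarith) (by positivity)
  have h3 : |f (dyadicUp (n + N + k) u) - f (dyadicDown (n + N + k) v)| ≤
      s * ρ₀ (v - u) + 2 * (B / (1 - q)) := by
    rw [abs_le] at hU hD hmid ⊢
    constructor <;> linarith [hU.1, hU.2, hD.1, hD.2, hmid.1, hmid.2]
  refine h3.trans (le_trans (le_of_eq ?_) (mul_le_mul_of_nonneg_right ht hR0))
  rw [hB]
  ring

theorem GridControl.abs_sub_le_of_continuous (h : GridControl ρ₀ s N j f)
    (hρ : PowerGauge ρ₀ p K)
    (hs : 0 ≤ s) (hN : 2 ≤ N) {t : ℝ}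
    (ht : s * (1 + 2 * (K * ((1 / 2 : ℝ) ^ p) ^ N / (1 - (1 / 2 : ℝ) ^ p))) ≤ t)
    (hf : Continuous f) {u v : I} (hj : |(u : ℝ) - v| ≤ (1 / 2) ^ j) :
    |f u - f v| ≤ t * ρ₀ |(u : ℝ) - v| := by
  wlog huv : (u : ℝ) ≤ v generalizing u v
  · rw [abs_sub_comm] at hj
    have := this hj (le_of_not_ge huv)
    rwa [abs_sub_comm, abs_sub_comm (u : ℝ)]
  rcases huv.eq_or_lt with heq | hlt
  · rw [Subtype.ext heq]
    simp [hρ.map_zero]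
  rw [abs_sub_comm (u : ℝ), abs_of_pos (sub_pos.2 hlt)] at hj ⊢
  obtain ⟨m, hm⟩ := h.dyadicUp_dyadicDown hρ hs hN ht hlt hj
  refine le_of_tendsto (Tendsto.abs (((hf.tendsto u).comp (tendsto_dyadicUp u)).sub
    ((hf.tendsto v).comp (tendsto_dyadicDown v)))) ?_
  filter_upwards [eventually_ge_atTop m] with M hM using hm M hM

theorem exists_chaining_level (hρ : PowerGauge ρ₀ p K) {t : ℝ} (hst : s < t) :
    ∃ N, 2 ≤ N ∧ s * (1 + 2 * (K * ((1 / 2 : ℝ) ^ p) ^ N / (1 - (1 / 2 : ℝ) ^ p))) ≤ t := by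
  have h1 := tendsto_pow_atTop_nhds_zero_of_lt_one
    (Real.rpow_pos_of_pos (by norm_num : (0 : ℝ) < 1 / 2) p).le (half_rpow_lt_one hρ.p_pos)
  have h2 : Tendsto (fun N : ℕ => s * (1 + 2 * (K * ((1 / 2 : ℝ) ^ p) ^ N /
      (1 - (1 / 2 : ℝ) ^ p)))) atTop (𝓝 s) := by
    simpa using ((((h1.const_mul K).div_const (1 - (1 / 2 : ℝ) ^ p)).const_mul 2).const_add
      1).const_mul s
  obtain ⟨N, hN1, hN2⟩ := ((eventually_ge_atTop 2).and (h2.eventually_le_const hst)).exists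
  exact ⟨N, hN1, hN2⟩
end

theorem weightedIncr_le_iff {ρ : ℝ → ℝ} {f : I → ℝ} {u v : I} {t : ℝ}
    (hρ : 0 ≤ ρ |(u : ℝ) - v|) (ht : 0 ≤ t) :
    weightedIncr ρ f u v ≤ ENNReal.ofReal t ↔ |f u - f v| ≤ t * ρ |(u : ℝ) - v| := by
  rw [weightedIncr, ENNReal.div_le_iff_le_mul (Or.inr ENNReal.ofReal_ne_top)
    (Or.inl ENNReal.ofReal_ne_top), ← ENNReal.ofReal_mul ht, Real.enorm_eq_ofReal_abs,
    ENNReal.ofReal_le_ofReal_iff (mul_nonneg ht hρ)]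

theorem lt_weightedIncr_iff {ρ : ℝ → ℝ} {f : I → ℝ} {u v : I} {t : ℝ}
    (hρ : 0 ≤ ρ |(u : ℝ) - v|) (ht : 0 ≤ t) :
    ENNReal.ofReal t < weightedIncr ρ f u v ↔ t * ρ |(u : ℝ) - v| < |f u - f v| := by
  rw [← not_le, weightedIncr_le_iff hρ ht, not_le]

/-- The increments of a process exceed `s * ρ₀` with probability at most `K * |u - v| ^ κ`. -/
def IncrTail {Ω : Type*} [MeasurableSpace Ω] (P : Measure Ω) (W : I → Ω → ℝ) (ρ₀ : ℝ → ℝ)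
    (s κ K : ℝ) : Prop :=
  ∀ u v : I, P {ω | s * ρ₀ |(u : ℝ) - v| < |W u ω - W v ω|} ≤
    ENNReal.ofReal (K * |(u : ℝ) - v| ^ κ)

/-- Bound for the probability that grid control fails at level `m`. -/
noncomputable def gridLevelBound (κ K : ℝ) (N m : ℕ) : ℝ≥0∞ :=
  ENNReal.ofReal (2 ^ m * (2 ^ N * (K * (2 ^ N / 2 ^ m) ^ κ)))

theorem tsum_gridLevelBound_ne_top {κ K : ℝ} (hκ : 1 < κ) (N : ℕ) :
    ∑' m, gridLevelBound κ K N m ≠ ∞ := by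
  have hq : (2 : ℝ) * (1 / 2) ^ κ < 1 := by
    have := Real.rpow_lt_rpow_of_exponent_gt (by norm_num : (0 : ℝ) < 1 / 2) (by norm_num) hκ
    rw [Real.rpow_one] at this
    linarith
  have hs : Summable fun m : ℕ => (2 : ℝ) ^ m * (2 ^ N * (K * (2 ^ N / 2 ^ m) ^ κ)) := by
    have h := (summable_geometric_of_lt_one (by positivity) hq).mul_left
      (2 ^ N * K * ((2 : ℝ) ^ N) ^ κ)
    refine h.congr fun m => ?_
    have e : ((2 : ℝ) ^ N / 2 ^ m) ^ κ = (2 ^ N) ^ κ * ((1 / 2 : ℝ) ^ κ) ^ m := by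
      rw [div_eq_mul_one_div, ← one_div_pow, Real.mul_rpow (by positivity) (by positivity),
        ← Real.rpow_natCast (1 / 2), ← Real.rpow_natCast ((1 / 2) ^ κ),
        ← Real.rpow_mul (by norm_num), ← Real.rpow_mul (by norm_num), mul_comm κ]
    rw [e, mul_pow]
    ring
  exact hs.tsum_ofReal_ne_top

theorem IncrTail.measure_not_gridControl_le {Ω : Type*} [MeasurableSpace Ω] {P : Measure Ω}
    {W : I → Ω → ℝ} {ρ₀ : ℝ → ℝ} {s κ K : ℝ} (h : IncrTail P W ρ₀ s κ K) (hκ : 0 ≤ κ)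
    (hK : 0 ≤ K) (N j : ℕ) :
    P {ω | ¬ GridControl ρ₀ s N j fun u => W u ω} ≤ ∑' k, gridLevelBound κ K N (k + j) := by
  have hsub : {ω | ¬ GridControl ρ₀ s N j fun u => W u ω} ⊆
      ⋃ k : ℕ, ⋃ a ∈ Finset.range (2 ^ (k + j)), ⋃ d ∈ Finset.range (2 ^ N),
        {ω | s * ρ₀ |(dyadicPt (k + j) a : ℝ) - dyadicPt (k + j) (a + d + 1)| <
          |W (dyadicPt (k + j) a) ω - W (dyadicPt (k + j) (a + d + 1)) ω|} := by
    intro ω hω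
    simp only [GridControl, Set.mem_ofPred_eq, not_forall, not_le] at hω
    obtain ⟨m, hm, a, ha, d, hd, hlt⟩ := hω
    obtain ⟨k, rfl⟩ := Nat.exists_eq_add_of_le' hm
    simp only [Set.mem_iUnion, Finset.mem_range]
    exact ⟨k, a, ha, d, hd, hlt⟩
  refine (measure_mono hsub).trans ((measure_iUnion_le _).trans (ENNReal.tsum_le_tsum fun k => ?_))
  refine (measure_biUnion_finset_le _ _).trans ((Finset.sum_le_sum (g := fun _ =>
    ∑ _d ∈ Finset.range (2 ^ N), ENNReal.ofReal (K * (2 ^ N / 2 ^ (k + j)) ^ κ)) fun a _ =>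
    (measure_biUnion_finset_le _ _).trans (Finset.sum_le_sum fun d hd => ?_)).trans ?_)
  · refine (h _ _).trans (ENNReal.ofReal_le_ofReal (mul_le_mul_of_nonneg_left ?_ hK))
    refine Real.rpow_le_rpow (abs_nonneg _) ((abs_dyadicPt_sub_le _ _ _).trans ?_) hκ
    gcongr
    have hd' : ((d + 1 : ℕ) : ℝ) ≤ ((2 ^ N : ℕ) : ℝ) := by
      have := Finset.mem_range.1 hd
      exact_mod_cast this
    push_cast at hd' ⊢
    rw [abs_le]
    constructor <;> linarith [(d.cast_nonneg : (0 : ℝ) ≤ d)]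
  · simp only [Finset.sum_const, Finset.card_range, nsmul_eq_mul, gridLevelBound]
    have e (i : ℕ) : ((2 ^ i : ℕ) : ℝ≥0∞) = ENNReal.ofReal (2 ^ i) := by
      rw [ENNReal.ofReal_pow (by norm_num)]
      simp
    rw [e, e, ENNReal.ofReal_mul (p := 2 ^ (k + j)) (by positivity),
      ENNReal.ofReal_mul (p := 2 ^ N) (by positivity)]

/-- `f` has increments at most `t * ρ₀` over distances at most `h`. -/
def LocalControl (ρ₀ : ℝ → ℝ) (t h : ℝ) (f : I → ℝ) : Prop :=
  ∀ u v : I, |(u : ℝ) - v| ≤ h → |f u - f v| ≤ t * ρ₀ |(u : ℝ) - v|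

theorem LocalControl.anti {ρ₀ : ℝ → ℝ} {t h h' : ℝ} {f : I → ℝ} (hf : LocalControl ρ₀ t h f)
    (hh : h' ≤ h) : LocalControl ρ₀ t h' f := fun u v huv => hf u v (huv.trans hh)

theorem localHolder_le_iff {ρ : ℝ → ℝ} (hρ : ∀ h ∈ Set.Icc (0 : ℝ) 1, 0 ≤ ρ h) {t h : ℝ}
    (ht : 0 ≤ t) {f : I → ℝ} : localHolder ρ h f ≤ ENNReal.ofReal t ↔ LocalControl ρ t h f := by
  simp only [localHolder, iSup_le_iff, LocalControl]
  refine forall₃_congr fun u v _ => weightedIncr_le_iff (hρ _ (abs_sub_mem_Icc u v)) ht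

/-- Uniform control of the local modulus for all continuous processes with the same increment
tails. -/
theorem exists_localControl_bound {ρ₀ : ℝ → ℝ} {p K' s t κ K : ℝ} (hρ : PowerGauge ρ₀ p K')
    (hs : 0 ≤ s) (hst : s < t) (hκ : 1 < κ) (hK : 0 ≤ K) :
    ∃ b : ℕ → ℝ≥0∞, Tendsto b atTop (𝓝 0) ∧
      ∀ {Ω : Type*} [MeasurableSpace Ω] (P : Measure Ω) (W : I → Ω → ℝ),
        (∀ ω, Continuous fun u => W u ω) → IncrTail P W ρ₀ s κ K →
        ∀ j, P {ω | ¬ LocalControl ρ₀ t ((1 / 2) ^ j) fun u => W u ω} ≤ b j := by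
  obtain ⟨N, hN, hNt⟩ := exists_chaining_level hρ hst
  refine ⟨_, ENNReal.tendsto_sum_nat_add _ (tsum_gridLevelBound_ne_top hκ N),
    fun P W hW h j => (measure_mono fun ω hω => ?_).trans
      (h.measure_not_gridControl_le (by linarith) hK N j)⟩
  exact fun hg => hω fun u v huv => hg.abs_sub_le_of_continuous hρ hs hN hNt (hW ω) huv

/-- A process with small increment tails has a continuous modification. -/
theorem IncrTail.exists_modification {Ω : Type*} [MeasurableSpace Ω] {P : Measure Ω}
    {W : I → Ω → ℝ} (hW : ∀ u, Measurable (W u)) {ρ₀ : ℝ → ℝ} {p K' s κ K : ℝ}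
    (hρ : PowerGauge ρ₀ p K')
    (hs : 0 ≤ s) (hκ : 1 < κ) (hK : 0 ≤ K) (h : IncrTail P W ρ₀ s κ K) :
    ∃ V : I → Ω → ℝ, IsContinuousProcess V ∧ ∀ u, V u =ᵐ[P] W u := by
  obtain ⟨N, hN, hNt⟩ := exists_chaining_level hρ (lt_add_one s)
  set G : Set Ω := {ω | ∃ j, GridControl ρ₀ s N j fun u => W u ω} with hG
  have hGm : MeasurableSet G := by
    have : G = ⋃ j : ℕ, ⋂ m : ℕ, ⋂ _ : j ≤ m, ⋂ a : ℕ, ⋂ _ : a < 2 ^ m, ⋂ d : ℕ,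
        ⋂ _ : d < 2 ^ N, {ω | |W (dyadicPt m a) ω - W (dyadicPt m (a + d + 1)) ω| ≤
          s * ρ₀ |(dyadicPt m a : ℝ) - dyadicPt m (a + d + 1)|} := by
      ext ω
      simp only [hG, GridControl, Set.mem_ofPred_eq, Set.mem_iUnion, Set.mem_iInter]
    rw [this]
    refine MeasurableSet.iUnion fun j => MeasurableSet.iInter fun m => MeasurableSet.iInter fun _ =>
      MeasurableSet.iInter fun a => MeasurableSet.iInter fun _ => MeasurableSet.iInter fun d =>
      MeasurableSet.iInter fun _ => measurableSet_le ?_ measurable_const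
    exact ((hW _).sub (hW _)).abs
  have hGae : ∀ᵐ ω ∂P, ω ∈ G := by
    have hb := ENNReal.tendsto_sum_nat_add _ (tsum_gridLevelBound_ne_top (K := K) hκ N)
    refine le_antisymm (ge_of_tendsto' hb fun j => ?_) zero_le
    refine (measure_mono fun ω hω => ?_).trans (h.measure_not_gridControl_le (by linarith) hK N j)
    exact fun hg => hω ⟨j, hg⟩
  set q : ℝ := (1 / 2 : ℝ) ^ p with hq
  have hq0 : 0 < q := Real.rpow_pos_of_pos (by norm_num) _
  have hq1 : q < 1 := half_rpow_lt_one hρ.p_pos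
  have hlim : ∀ ω ∈ G, ∀ u, ∃ y, Tendsto (fun m => W (dyadicDown m u) ω) atTop (𝓝 y) := by
    rintro ω ⟨j, hg⟩ u
    have hc : CauchySeq fun k => W (dyadicDown (k + j) u) ω := by
      refine cauchySeq_of_le_geometric q (s * (K' * q * ρ₀ ((1 / 2) ^ j))) hq1 fun k => ?_
      have h1 := hg.dyadicDown_succ hρ hs (Nat.le_add_left j k) u
      have h2 := hρ.half_pow_add_le j (k + 1)
      rw [Real.dist_eq, add_right_comm k 1 j]
      rw [show k + j + 1 = j + (k + 1) by ring] at h1 ⊢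
      refine h1.trans ((mul_le_mul_of_nonneg_left h2 hs).trans (le_of_eq ?_))
      ring
    obtain ⟨y, hy⟩ := cauchySeq_tendsto_of_complete hc
    exact ⟨y, (tendsto_add_atTop_iff_nat j).1 hy⟩
  choose! L hL using hlim
  have hρ0 : Tendsto (fun m : ℕ => s * ρ₀ ((1 / 2) ^ m)) atTop (𝓝 0) := by
    have h1 : Tendsto (fun m : ℕ => s * (K' * q ^ m * ρ₀ ((1 / 2) ^ 0))) atTop (𝓝 0) := by
      have := (((tendsto_pow_atTop_nhds_zero_of_lt_one hq0.le hq1).const_mul K').mul_const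
        (ρ₀ ((1 / 2) ^ 0))).const_mul s
      simpa using this
    refine squeeze_zero (fun m => mul_nonneg hs (hρ.nonneg _ (half_pow_mem_Icc m))) (fun m => ?_) h1
    have := hρ.half_pow_add_le 0 m
    rw [zero_add] at this
    exact mul_le_mul_of_nonneg_left this hs
  classical
  refine ⟨fun u ω => if ω ∈ G then L ω u else 0, ⟨fun u => ?_, fun ω => ?_⟩, fun u => ?_⟩
  · refine measurable_of_tendsto_metrizable
      (f := fun m ω => if ω ∈ G then W (dyadicDown m u) ω else 0)
      (fun m => Measurable.ite hGm (hW _) measurable_const) ?_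
    rw [tendsto_pi_nhds]
    intro ω
    by_cases hω : ω ∈ G
    · simpa [hω] using hL ω hω u
    · simp [hω]
  · by_cases hω : ω ∈ G
    swap
    · simpa [hω] using continuous_const
    simp only [hω, if_true]
    obtain ⟨j, hg⟩ := id hω
    have hup : ∀ u, Tendsto (fun m => W (dyadicUp m u) ω) atTop (𝓝 (L ω u)) := by
      intro u
      have h0 : Tendsto (fun m => W (dyadicUp m u) ω - W (dyadicDown m u) ω) atTop (𝓝 0) := by
        refine squeeze_zero_norm' ?_ hρ0
        filter_upwards [eventually_ge_atTop j] with m hm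
        rw [Real.norm_eq_abs, abs_sub_comm]
        exact hg.dyadicDown_dyadicUp hρ hs hm u
      simpa using h0.add (hL ω hω u)
    have hinc : ∀ u v : I, (u : ℝ) < v → (v : ℝ) - u ≤ (1 / 2) ^ j →
        |L ω u - L ω v| ≤ (s + 1) * ρ₀ (v - u) := by
      intro u v huv hj
      obtain ⟨m, hm⟩ := hg.dyadicUp_dyadicDown hρ hs hN hNt huv hj
      refine le_of_tendsto ((hup u).sub (hL ω hω v)).abs ?_
      filter_upwards [eventually_ge_atTop m] with M hM using hm M hM
    have hinc' : ∀ u v : I, |(u : ℝ) - v| ≤ (1 / 2) ^ j →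
        |L ω u - L ω v| ≤ (s + 1) * (K' * ρ₀ 1 * |(u : ℝ) - v| ^ p) := by
      intro u v huv
      refine le_trans ?_ (mul_le_mul_of_nonneg_left (hρ.le_rpow (abs_sub_mem_Icc u v))
        (by linarith))
      rcases lt_trichotomy (u : ℝ) v with hlt | heq | hlt
      · rw [abs_sub_comm (u : ℝ), abs_of_pos (sub_pos.2 hlt)] at huv ⊢
        exact hinc u v hlt huv
      · rw [Subtype.ext heq]
        simp [hρ.map_zero]
      · rw [abs_of_pos (sub_pos.2 hlt)] at huv ⊢
        rw [abs_sub_comm]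
        exact hinc v u hlt huv
    rw [continuous_iff_continuousAt]
    intro v
    rw [ContinuousAt, tendsto_iff_norm_sub_tendsto_zero]
    have hc : Tendsto (fun u : I => (s + 1) * (K' * ρ₀ 1 * |(u : ℝ) - v| ^ p)) (𝓝 v) (𝓝 0) := by
      have : Continuous fun u : I => (s + 1) * (K' * ρ₀ 1 * |(u : ℝ) - v| ^ p) := by
        have h1 : Continuous fun u : I => |(u : ℝ) - v| ^ p :=
          Continuous.rpow_const (by fun_prop) fun _ => Or.inr hρ.p_pos.le
        fun_prop
      have h2 := this.tendsto v
      simpa [Real.zero_rpow hρ.p_pos.ne'] using h2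
    refine squeeze_zero' (Eventually.of_forall fun _ => norm_nonneg _) ?_ hc
    have hnear : ∀ᶠ u : I in 𝓝 v, |(u : ℝ) - v| < (1 / 2) ^ j := by
      have : Continuous fun u : I => |(u : ℝ) - v| := by fun_prop
      refine (this.tendsto v).eventually_lt_const ?_
      simp
    filter_upwards [hnear] with u hu using hinc' u v hu.le
  · have hsum : ∑' m : ℕ, P {ω | s * ρ₀ |(dyadicDown m u : ℝ) - u| <
        |W (dyadicDown m u) ω - W u ω|} ≠ ∞ := by
      have hg : Summable fun m : ℕ => K * ((1 / 2 : ℝ) ^ κ) ^ m :=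
        (summable_geometric_of_lt_one (by positivity)
          (half_rpow_lt_one (by linarith))).mul_left _
      refine ne_top_of_le_ne_top hg.tsum_ofReal_ne_top (ENNReal.tsum_le_tsum fun m => ?_)
      refine (h _ _).trans (ENNReal.ofReal_le_ofReal (mul_le_mul_of_nonneg_left ?_ hK))
      rw [← Real.rpow_natCast, ← Real.rpow_mul (by norm_num), mul_comm,
        Real.rpow_mul (by norm_num), Real.rpow_natCast]
      exact Real.rpow_le_rpow (abs_nonneg _) (abs_dyadicDown_sub_le m u) (by linarith)
    filter_upwards [hGae, ae_eventually_notMem hsum] with ω hω hev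
    simp only [hω, if_true]
    refine tendsto_nhds_unique (hL ω hω u) ?_
    rw [tendsto_iff_norm_sub_tendsto_zero]
    refine squeeze_zero' (Eventually.of_forall fun _ => norm_nonneg _) ?_ hρ0
    filter_upwards [hev] with m hm
    simp only [not_lt] at hm
    refine hm.trans (mul_le_mul_of_nonneg_left ?_ hs)
    exact hρ.mono (abs_sub_mem_Icc _ _) (half_pow_mem_Icc m) (abs_dyadicDown_sub_le m u)

section
variable {Ω : ℕ → Type*} [∀ n, MeasurableSpace (Ω n)] {P : ∀ n, Measure (Ω n)}
  {Ω' : Type*} [MeasurableSpace Ω'] {P' : Measure Ω'}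

/-- The open-set form of weak convergence passes to the limit under approximation in probability,
uniformly along the sequence. -/
theorem measure_preimage_open_le_liminf_of_approx {E : Type*} [PseudoEMetricSpace E]
    {Y : ∀ n, Ω n → E} {Y' : Ω' → E}
    (h : ∀ ε : ℝ, 0 < ε → ∃ (Z : ∀ n, Ω n → E) (Z' : Ω' → E),
      (∀ U, IsOpen U → P' (Z' ⁻¹' U) ≤ liminf (fun n => P n (Z n ⁻¹' U)) atTop) ∧
      (∀ n, P n {ω | ENNReal.ofReal ε < edist (Y n ω) (Z n ω)} ≤ ENNReal.ofReal ε) ∧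
      P' {ω | ENNReal.ofReal ε < edist (Y' ω) (Z' ω)} ≤ ENNReal.ofReal ε)
    {G : Set E} (hG : IsOpen G) :
    P' (Y' ⁻¹' G) ≤ liminf (fun n => P n (Y n ⁻¹' G)) atTop := by
  set ε : ℕ → ℝ := fun k => 1 / ((k : ℝ) + 1) with hε
  have hεpos (k : ℕ) : 0 < ε k := by positivity
  have hεanti : Antitone ε := fun k l hkl => by
    have : (k : ℝ) ≤ l := by exact_mod_cast hkl
    simp only [hε]
    gcongr
  have hε0 : Tendsto (fun k => ENNReal.ofReal (ε k)) atTop (𝓝 0) := by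
    have := ENNReal.tendsto_ofReal tendsto_one_div_add_atTop_nhds_zero_nat
    rwa [ENNReal.ofReal_zero] at this
  set D : ℕ → Set E := fun k => {y | ENNReal.ofReal (ε k) + ENNReal.ofReal (ε k) <
    Metric.infEDist y Gᶜ} with hD
  have hDmono : Monotone D := fun k l hkl y hy => lt_of_le_of_lt
    (add_le_add (ENNReal.ofReal_le_ofReal (hεanti hkl)) (ENNReal.ofReal_le_ofReal (hεanti hkl))) hy
  have hDU : Y' ⁻¹' G = ⋃ k, Y' ⁻¹' D k := by
    ext ω
    simp only [Set.mem_preimage, Set.mem_iUnion]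
    constructor
    · intro hω
      have hpos : 0 < Metric.infEDist (Y' ω) Gᶜ := by
        rw [pos_iff_ne_zero]
        intro h0
        have := Metric.mem_closure_iff_infEDist_zero.2 h0
        rw [hG.isClosed_compl.closure_eq] at this
        exact this hω
      have h2 := hε0.add hε0
      rw [add_zero] at h2
      exact (h2.eventually_lt_const hpos).exists
    · rintro ⟨k, hk⟩
      by_contra hω
      have : Metric.infEDist (Y' ω) Gᶜ = 0 := Metric.infEDist_zero_of_mem hω
      simp only [hD, Set.mem_ofPred_eq, this, not_lt_zero] at hk
  have hstep (k : ℕ) : P' (Y' ⁻¹' D k) ≤ liminf (fun n => P n (Y n ⁻¹' G)) atTop +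
      ENNReal.ofReal (ε k) + ENNReal.ofReal (ε k) := by
    obtain ⟨Z, Z', hZ, hYZ, hYZ'⟩ := h (ε k) (hεpos k)
    set U : Set E := {y | ENNReal.ofReal (ε k) < Metric.infEDist y Gᶜ} with hU
    have hUo : IsOpen U := isOpen_lt continuous_const Metric.continuous_infEDist
    have h1 : P' (Y' ⁻¹' D k) ≤ P' (Z' ⁻¹' U) + ENNReal.ofReal (ε k) := by
      refine le_trans (measure_mono ?_) ((measure_union_le _ _).trans (add_le_add_right hYZ' _))
      intro ω hω
      by_cases hd : ENNReal.ofReal (ε k) < edist (Y' ω) (Z' ω)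
      · exact Or.inr hd
      · left
        have h2 : ENNReal.ofReal (ε k) + ENNReal.ofReal (ε k) <
            Metric.infEDist (Z' ω) Gᶜ + ENNReal.ofReal (ε k) := lt_of_lt_of_le hω
          (Metric.infEDist_le_infEDist_add_edist.trans (add_le_add_right (not_lt.1 hd) _))
        exact (ENNReal.add_lt_add_iff_right ENNReal.ofReal_ne_top).1 h2
    have h2 (n : ℕ) : P n (Z n ⁻¹' U) ≤ P n (Y n ⁻¹' G) + ENNReal.ofReal (ε k) := by
      refine le_trans (measure_mono ?_) ((measure_union_le _ _).trans (add_le_add_right (hYZ n) _))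
      intro ω hω
      by_cases hd : Y n ω ∈ G
      · exact Or.inl hd
      · right
        have h3 : ENNReal.ofReal (ε k) < edist (Z n ω) (Y n ω) :=
          lt_of_lt_of_le hω (Metric.infEDist_le_edist_of_mem hd)
        rwa [edist_comm] at h3
    have h3 : liminf (fun n => P n (Z n ⁻¹' U)) atTop ≤
        liminf (fun n => P n (Y n ⁻¹' G)) atTop + ENNReal.ofReal (ε k) := by
      rw [← liminf_add_const atTop _ _ (by isBoundedDefault) (by isBoundedDefault)]
      exact liminf_le_liminf (Eventually.of_forall h2)
    exact h1.trans (add_le_add_left ((hZ U hUo).trans h3) _)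
  rw [hDU, Monotone.measure_iUnion fun k l hkl => Set.preimage_mono (hDmono hkl)]
  refine iSup_le fun k => ?_
  have hlim := (hε0.const_add (liminf (fun n => P n (Y n ⁻¹' G)) atTop)).add hε0
  rw [add_zero, add_zero] at hlim
  refine ge_of_tendsto hlim ?_
  filter_upwards [eventually_ge_atTop k] with l hl
  exact (measure_mono (Set.preimage_mono (hDmono hl))).trans (hstep l)

/-- Continuous functions on a compact metric space are approximated, in terms of their modulus of
continuity, by continuous images of their values at finitely many points. -/
theorem exists_finite_interpolation (K : Type*) [PseudoMetricSpace K] [CompactSpace K] {δ : ℝ}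
    (hδ : 0 < δ) : ∃ (S : Finset K) (L : (S → ℝ) → C(K, ℝ)), Continuous L ∧
      ∀ (f : C(K, ℝ)) (ε : ℝ), 0 ≤ ε → (∀ x y, dist x y < δ → |f x - f y| ≤ ε) →
        dist f (L fun k => f k) ≤ ε := by
  obtain ⟨S, -, hS⟩ := isCompact_univ.elim_nhds_subcover (fun x : K => Metric.ball x δ)
    fun x _ => Metric.ball_mem_nhds x hδ
  have hφ0 (i x : K) : 0 ≤ max 0 (δ - dist x i) := le_max_left _ _
  have hpos (x : K) : 0 < ∑ i : S, max 0 (δ - dist x i) := by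
    obtain ⟨i, hi, hx⟩ := Set.mem_iUnion₂.1 (hS (Set.mem_univ x))
    refine Finset.sum_pos' (fun i _ => hφ0 i x) ⟨⟨i, hi⟩, Finset.mem_univ _, ?_⟩
    exact lt_max_of_lt_right (sub_pos.2 hx)
  set ψ : S → C(K, ℝ) := fun i =>
    ⟨fun x => max 0 (δ - dist x i) / ∑ i : S, max 0 (δ - dist x i),
      Continuous.div (by fun_prop) (by fun_prop) fun x => (hpos x).ne'⟩ with hψ
  refine ⟨S, fun w => ∑ i, w i • ψ i, by fun_prop, fun f ε hε hf => ?_⟩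
  rw [ContinuousMap.dist_le hε]
  intro x
  have hsum : ∑ i, ψ i x = 1 := by
    simp only [hψ, ContinuousMap.coe_mk]
    rw [← Finset.sum_div, div_self (hpos x).ne']
  have hψ0 (i : S) : 0 ≤ ψ i x := div_nonneg (hφ0 _ _) (hpos x).le
  have hdiff : f x - (∑ i : S, f i • ψ i) x = ∑ i : S, (f x - f i) * ψ i x := by
    simp only [sub_mul, Finset.sum_sub_distrib, ← Finset.mul_sum, hsum, mul_one]
    simp [ContinuousMap.sum_apply]
  rw [Real.dist_eq, hdiff]
  calc |∑ i : S, (f x - f i) * ψ i x| ≤ ∑ i : S, |(f x - f i) * ψ i x| :=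
        Finset.abs_sum_le_sum_abs _ _
    _ ≤ ∑ i : S, ε * ψ i x := Finset.sum_le_sum fun i _ => ?_
    _ = ε := by rw [← Finset.mul_sum, hsum, mul_one]
  rw [abs_mul, abs_of_nonneg (hψ0 i)]
  rcases lt_or_ge (dist x i) δ with hd | hd
  · exact mul_le_mul_of_nonneg_right (hf _ _ hd) (hψ0 i)
  · have : ψ i x = 0 := by
      simp only [hψ, ContinuousMap.coe_mk]
      rw [max_eq_left (by linarith), zero_div]
    simp [this]

theorem exists_uniform_modulus {K : Type*} [PseudoMetricSpace K] [CompactSpace K] (f : C(K, ℝ))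
    {ε : ℝ} (hε : 0 < ε) : ∃ δ > 0, ∀ x y, dist x y < δ → |f x - f y| ≤ ε := by
  have hu := CompactSpace.uniformContinuous_of_continuous f.continuous
  obtain ⟨δ, hδ, h⟩ := Metric.uniformContinuous_iff.1 hu ε hε
  exact ⟨δ, hδ, fun x y hxy => (h hxy).le⟩

/-- A map into a space that embeds into `C(K, ℝ)` is measurable if its evaluations are. -/
theorem measurable_of_isInducing_continuousMap {K : Type*} [PseudoMetricSpace K] [CompactSpace K]
    {E : Type*} [TopologicalSpace E] [MeasurableSpace E] [BorelSpace E] {Φ : E → C(K, ℝ)}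
    (hΦ : IsInducing Φ) {X : Ω' → E} (hX : ∀ x, Measurable fun ω => Φ (X ω) x) :
    Measurable X := by
  borelize C(K, ℝ)
  have h1 : Measurable fun ω => Φ (X ω) := by
    set δ : ℕ → ℝ := fun k => 1 / ((k : ℝ) + 1) with hδ
    have hδpos (k : ℕ) : 0 < δ k := by positivity
    choose S L hL hLf using fun k => exists_finite_interpolation K (hδpos k)
    refine measurable_of_tendsto_metrizable (f := fun k ω => L k fun i : S k => Φ (X ω) i)
      (fun k => (hL k).measurable.comp (measurable_pi_lambda _ fun i => hX i)) ?_
    rw [tendsto_pi_nhds]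
    intro ω
    rw [tendsto_iff_dist_tendsto_zero, Metric.tendsto_nhds]
    intro ε hε
    obtain ⟨η, hη, hf⟩ := exists_uniform_modulus (Φ (X ω)) (half_pos hε)
    filter_upwards [tendsto_one_div_add_atTop_nhds_zero_nat.eventually_lt_const hη] with k hk
    rw [Real.dist_0_eq_abs, abs_of_nonneg dist_nonneg, dist_comm]
    exact (hLf k _ _ (half_pos hε).le fun x y hxy => hf x y (hxy.trans hk)).trans_lt (by linarith)
  have hE : ‹MeasurableSpace E› = MeasurableSpace.comap Φ inferInstance := by
    rw [‹BorelSpace E›.measurable_eq, ‹BorelSpace C(K, ℝ)›.measurable_eq, ← borel_comap,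
      hΦ.eq_induced]
  rw [hE]
  exact measurable_comap_iff.2 h1

/-- Weak convergence in a space that embeds into `C(K, ℝ)` follows from convergence of the finite
dimensional marginals and stochastic equicontinuity. -/
theorem tendstoInDistribution_of_stochastic_equicontinuity [∀ n, IsProbabilityMeasure (P n)]
    [IsProbabilityMeasure P'] {K : Type*} [PseudoMetricSpace K]
    [CompactSpace K] {E : Type*} [TopologicalSpace E] [MeasurableSpace E] [BorelSpace E]
    {Φ : E → C(K, ℝ)} (hΦ : IsInducing Φ) {X : ∀ n, Ω n → E} {X' : Ω' → E}
    (hX : ∀ n x, Measurable fun ω => Φ (X n ω) x) (hX' : ∀ x, Measurable fun ω => Φ (X' ω) x)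
    (hfidi : ∀ (S : Finset K) (U : Set (S → ℝ)), IsOpen U →
      P' {ω | (fun k : S => Φ (X' ω) k) ∈ U} ≤
        liminf (fun n => P n {ω | (fun k : S => Φ (X n ω) k) ∈ U}) atTop)
    (hequi : ∀ ε : ℝ, 0 < ε → ∃ δ : ℝ, 0 < δ ∧
      (∀ n, P n {ω | ¬ ∀ x y, dist x y < δ → |Φ (X n ω) x - Φ (X n ω) y| ≤ ε} ≤
        ENNReal.ofReal ε) ∧
      P' {ω | ¬ ∀ x y, dist x y < δ → |Φ (X' ω) x - Φ (X' ω) y| ≤ ε} ≤ ENNReal.ofReal ε) :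
    TendstoInDistribution X atTop X' P P' := by
  have hm (n : ℕ) : Measurable (X n) := measurable_of_isInducing_continuousMap hΦ (hX n)
  have hm' : Measurable X' := measurable_of_isInducing_continuousMap hΦ hX'
  refine ⟨fun n => (hm n).aemeasurable, hm'.aemeasurable, ?_⟩
  apply tendsto_of_forall_isOpen_le_liminf'
  intro G hG
  simp only [ProbabilityMeasure.coe_mk]
  rw [Measure.map_apply hm' hG.measurableSet]
  simp_rw [fun n => Measure.map_apply (hm n) hG.measurableSet]
  obtain ⟨V, hV, rfl⟩ := hΦ.isOpen_iff.1 hG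
  refine measure_preimage_open_le_liminf_of_approx (Y := fun n ω => Φ (X n ω))
    (Y' := fun ω => Φ (X' ω)) (fun ε hε => ?_) hV
  obtain ⟨δ, hδ, h1, h2⟩ := hequi ε hε
  obtain ⟨S, L, hL, hLf⟩ := exists_finite_interpolation K hδ
  have hsub : ∀ f : C(K, ℝ), ENNReal.ofReal ε < edist f (L fun k => f k) →
      ¬ ∀ x y, dist x y < δ → |f x - f y| ≤ ε := by
    intro f hf hmod
    rw [edist_dist] at hf
    exact absurd (ENNReal.ofReal_le_ofReal (hLf f ε hε.le hmod)) (not_le.2 hf)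
  exact ⟨fun n ω => L fun k => Φ (X n ω) k, fun ω => L fun k => Φ (X' ω) k,
    fun U hU => hfidi S _ (hU.preimage hL),
    fun n => (measure_mono fun ω hω => hsub _ hω).trans (h1 n),
    (measure_mono fun ω hω => hsub _ hω).trans h2⟩
end

section
variable {ρ ρ₀ : ℝ → ℝ}

theorem IsModulus.nonneg (hρ : IsModulus ρ) : ∀ h ∈ Set.Icc (0 : ℝ) 1, 0 ≤ ρ h := fun h hh => by
  rw [← hρ.map_zero]
  exact hρ.monotoneOn ⟨le_rfl, zero_le_one⟩ hh hh.1

theorem IsModulus.continuous_abs_sub (hρ : IsModulus ρ) {X : Type*} [TopologicalSpace X]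
    {f g : X → I} (hf : Continuous f) (hg : Continuous g) :
    Continuous fun x => ρ |(f x : ℝ) - g x| :=
  hρ.continuousOn.comp_continuous (by fun_prop) fun x => abs_sub_mem_Icc (f x) (g x)

/-- Increments of a function with controlled local modulus are bounded, by chaining. -/
theorem LocalControl.abs_sub_le {t h : ℝ}
    (hmono : MonotoneOn ρ (Set.Icc 0 1)) (ht : 0 ≤ t) (hh : 0 < h) {f : I → ℝ}
    (hf : LocalControl ρ t h f) (u v : I) : |f u - f v| ≤ ⌈1 / h⌉₊ * (t * ρ 1) := by
  set n := ⌈1 / h⌉₊ with hn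
  have hn0 : (0 : ℝ) < n := Nat.cast_pos.2 (Nat.ceil_pos.2 (by positivity))
  have hn1 : 1 / (n : ℝ) ≤ h := (one_div_le hn0 hh).2 (Nat.le_ceil _)
  set x : ℕ → I := fun k => Set.projIcc 0 1 zero_le_one ((u : ℝ) + k / n * (v - u)) with hx
  have h0 : x 0 = u := by simp [hx]
  have h1 : x n = v := by
    simp only [hx]
    rw [div_self hn0.ne', one_mul, add_sub_cancel, Set.projIcc_val]
  have hstep (k : ℕ) : |(x k : ℝ) - x (k + 1)| ≤ h := by
    simp only [hx]
    rw [Set.coe_projIcc, Set.coe_projIcc]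
    refine (abs_max_sub_max_le_max _ _ _ _).trans ?_
    rw [sub_self, abs_zero, max_eq_right (abs_nonneg _)]
    refine (abs_min_sub_min_le_max _ _ _ _).trans ?_
    rw [sub_self, abs_zero, max_eq_right (abs_nonneg _)]
    have : (u : ℝ) + k / n * (v - u) - (u + (k + 1 : ℕ) / n * (v - u)) = 1 / n * (u - v) := by
      push_cast
      ring
    rw [this, abs_mul, abs_of_pos (by positivity)]
    exact (mul_le_of_le_one_right (by positivity) (abs_sub_mem_Icc u v).2).trans hn1
  have hd := dist_le_range_sum_of_dist_le (f := fun k => f (x k)) (d := fun _ => t * ρ 1) n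
    fun {k} _ => by
      rw [Real.dist_eq]
      refine (hf _ _ (hstep k)).trans (mul_le_mul_of_nonneg_left ?_ ht)
      exact hmono (abs_sub_mem_Icc _ _) (by simp) (abs_sub_mem_Icc _ _).2
  simpa [h0, h1, Real.dist_eq] using hd

theorem LocalControl.of_le {t r A : ℝ} (hρ₀ : ρ₀ 0 = 0) (hρ : ρ 0 = 0) (ht : 0 ≤ t)
    (hle : ∀ x ∈ Set.Ioc 0 r, ρ₀ x ≤ A * ρ x) {f : I → ℝ} (hf : LocalControl ρ₀ t r f) :
    LocalControl ρ (t * A) r f := by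
  intro u v huv
  refine (hf u v huv).trans ?_
  rw [mul_assoc]
  refine mul_le_mul_of_nonneg_left ?_ ht
  rcases (abs_nonneg ((u : ℝ) - v)).eq_or_lt with h0 | h0
  · rw [← h0, hρ, hρ₀, mul_zero]
  · exact hle _ ⟨h0, huv⟩

theorem exists_radius_of_eventually {A h : ℝ} (hh : 0 < h)
    (hle : ∀ᶠ x in 𝓝[>] 0, ρ₀ x ≤ A * ρ x) :
    ∃ r, 0 < r ∧ r ≤ h ∧ ∀ x ∈ Set.Ioc 0 r, ρ₀ x ≤ A * ρ x := by
  obtain ⟨r, hr, hsub⟩ := mem_nhdsGT_iff_exists_Ioc_subset.1 hle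
  exact ⟨min r h, lt_min hr hh, min_le_right _ _,
    fun x hx => hsub ⟨hx.1, hx.2.trans (min_le_left _ _)⟩⟩

theorem MuchLarger.eventually_le (hm : MuchLarger ρ ρ₀) (hρ : IsModulus ρ) {A : ℝ} (hA : 0 < A) :
    ∀ᶠ x in 𝓝[>] 0, ρ₀ x ≤ A * ρ x := by
  filter_upwards [hm.eventually_le_const hA, Ioc_mem_nhdsGT zero_lt_one] with x hx hx1
  rwa [div_le_iff₀ (hρ.pos x hx1)] at hx

theorem eventually_le_mul_of_tendsto_div_one (hρ₀ : ∀ h ∈ Set.Icc (0 : ℝ) 1, 0 ≤ ρ₀ h)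
    (h : Tendsto (fun h => ρ h / ρ₀ h) (𝓝[>] 0) (𝓝 1)) {A : ℝ} (hA : 1 < A) :
    ∀ᶠ x in 𝓝[>] 0, ρ₀ x ≤ A * ρ x := by
  have hA0 : 0 < A := by linarith
  filter_upwards [h.eventually_const_lt (inv_lt_one_of_one_lt₀ hA), Ioc_mem_nhdsGT zero_lt_one]
    with x hx hx1
  rcases (hρ₀ x ⟨hx1.1.le, hx1.2⟩).eq_or_lt with h0 | h0
  · rw [← h0, div_zero] at hx
    exact absurd hx (not_lt.2 (inv_pos.2 hA0).le)
  · rw [lt_div_iff₀ h0, inv_mul_lt_iff₀ hA0] at hx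
    exact hx.le

theorem holderSeminorm_le_of {t : ℝ} (hρ : IsModulus ρ) (ht : 0 ≤ t) {f : I → ℝ}
    (hf : ∀ u v, |f u - f v| ≤ t * ρ |(u : ℝ) - v|) : holderSeminorm ρ f ≤ ENNReal.ofReal t :=
  iSup₂_le fun u v => (weightedIncr_le_iff (hρ.nonneg _ (abs_sub_mem_Icc u v)) ht).2 (hf u v)

theorem abs_sub_le_of_holderSeminorm_le {t : ℝ} (hρ : IsModulus ρ) (ht : 0 ≤ t) {f : I → ℝ}
    (hf : holderSeminorm ρ f ≤ ENNReal.ofReal t) (u v : I) :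
    |f u - f v| ≤ t * ρ |(u : ℝ) - v| :=
  (weightedIncr_le_iff (hρ.nonneg _ (abs_sub_mem_Icc u v)) ht).1
    ((le_iSup₂ (f := fun u v => weightedIncr ρ f u v) u v).trans hf)

/-- Local control at scale `ρ₀` bounds the seminorm for every modulus that dominates `ρ₀`. -/
theorem exists_holderSeminorm_le {p K t h A : ℝ} (hρ₀ : PowerGauge ρ₀ p K) (hρ : IsModulus ρ)
    (ht : 0 ≤ t) (hh : 0 < h) (hA : 0 ≤ A) (hle : ∀ᶠ x in 𝓝[>] 0, ρ₀ x ≤ A * ρ x) :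
    ∃ M : ℝ, ∀ f : I → ℝ, LocalControl ρ₀ t h f → holderSeminorm ρ f ≤ ENNReal.ofReal M := by
  obtain ⟨r, hr0, hrh, hr⟩ := exists_radius_of_eventually hh hle
  set r' := min r 1 with hr'
  have hr'0 : 0 < r' := lt_min hr0 zero_lt_one
  have hpos := hρ.pos r' ⟨hr'0, min_le_right _ _⟩
  set B : ℝ := ⌈1 / h⌉₊ * (t * ρ₀ 1) with hB
  have hB0 : 0 ≤ B := mul_nonneg (Nat.cast_nonneg _) (mul_nonneg ht (hρ₀.nonneg 1 (by simp)))
  refine ⟨t * A + B / ρ r', fun f hf => holderSeminorm_le_of hρ (by positivity) fun u v => ?_⟩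
  have hρ0 := hρ.nonneg _ (abs_sub_mem_Icc u v)
  rw [add_mul]
  rcases le_or_gt |(u : ℝ) - v| r with huv | huv
  · refine le_add_of_le_of_nonneg ?_ (by positivity)
    exact (hf.anti hrh).of_le hρ₀.map_zero hρ.map_zero ht hr u v huv
  · refine le_add_of_nonneg_of_le (by positivity) ?_
    refine (hf.abs_sub_le hρ₀.mono ht hh u v).trans ?_
    rw [div_mul_eq_mul_div, le_div_iff₀ hpos]
    refine mul_le_mul_of_nonneg_left ?_ hB0
    exact hρ.monotoneOn ⟨hr'0.le, min_le_right _ _⟩ (abs_sub_mem_Icc u v)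
      ((min_le_left _ _).trans huv.le)

theorem tendsto_localHolder_zero_iff (hρ : IsModulus ρ) {f : I → ℝ} :
    Tendsto (fun δ => localHolder ρ δ f) (𝓝[>] 0) (𝓝 0) ↔
      ∀ ε : ℝ, 0 < ε → ∃ r, 0 < r ∧ LocalControl ρ ε r f := by
  rw [ENNReal.tendsto_nhds_zero]
  constructor
  · intro h ε hε
    obtain ⟨r, hr, hr0⟩ := ((h _ (ENNReal.ofReal_pos.2 hε)).and self_mem_nhdsWithin).exists
    exact ⟨r, hr0, (localHolder_le_iff hρ.nonneg hε.le).1 hr⟩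
  · intro h ε hε
    obtain ⟨e, he0, heε⟩ := ENNReal.lt_iff_exists_nnreal_btwn.1 hε
    have he : (0 : ℝ) < e := by exact_mod_cast he0
    obtain ⟨r, hr0, hr⟩ := h e he
    filter_upwards [Ioc_mem_nhdsGT hr0] with δ hδ
    refine le_trans ?_ heε.le
    rw [← ENNReal.ofReal_coe_nnreal]
    exact (localHolder_le_iff hρ.nonneg he.le).2 (hr.anti hδ.2)

theorem LocalControl.exists_of_muchLarger {p K t h : ℝ} (hρ₀ : PowerGauge ρ₀ p K)
    (hρ : IsModulus ρ) (hm : MuchLarger ρ ρ₀) (ht : 0 < t) (hh : 0 < h) {ε : ℝ} (hε : 0 < ε) :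
    ∃ r, 0 < r ∧ ∀ f, LocalControl ρ₀ t h f → LocalControl ρ ε r f := by
  obtain ⟨r, hr0, hrh, hr⟩ := exists_radius_of_eventually hh (hm.eventually_le hρ (div_pos hε ht))
  refine ⟨r, hr0, fun f hf => ?_⟩
  have := (hf.anti hrh).of_le hρ₀.map_zero hρ.map_zero ht.le hr
  rwa [mul_div_cancel₀ _ ht.ne'] at this

/-- The function on the square that encodes both the value `f 0` and the weighted increments. -/
noncomputable def holderLift (ρ : ℝ → ℝ) (f : I → ℝ) (k : I × I) : ℝ :=
  f 0 + (f k.1 - f k.2) / ρ |(k.1 : ℝ) - k.2|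

theorem equicontinuous_holderLift (hρ : IsModulus ρ) {ι : Type*} {F : ι → I → ℝ}
    (hF : ∀ ε : ℝ, 0 < ε → ∃ r, 0 < r ∧ ∀ i, LocalControl ρ ε r (F i)) :
    Equicontinuous fun i => holderLift ρ (F i) := by
  have hcont : Continuous fun x : I × I => ρ |(x.1 : ℝ) - x.2| :=
    hρ.continuous_abs_sub continuous_fst continuous_snd
  have hnear (g : I × I → ℝ) (hg : Continuous g) (x₀ : I × I) (h0 : g x₀ = 0) {r : ℝ}
      (hr : 0 < r) : ∀ᶠ x in 𝓝 x₀, g x < r :=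
    (hg.tendsto x₀).eventually_lt_const (h0 ▸ hr)
  rintro ⟨u₀, v₀⟩
  by_cases huv : u₀ = v₀
  · subst huv
    rw [Metric.equicontinuousAt_iff_right]
    intro ε hε
    obtain ⟨r, hr, hFr⟩ := hF (ε / 2) (half_pos hε)
    filter_upwards [hnear (fun x => |(x.1 : ℝ) - x.2|) (by fun_prop) (u₀, u₀) (by simp) hr]
      with x hx i
    rw [dist_comm, Real.dist_eq]
    simp only [holderLift, sub_self, zero_div, add_zero, add_sub_cancel_left]
    have h1 := hFr i _ _ hx.le
    rw [abs_div, abs_of_nonneg (hρ.nonneg _ (abs_sub_mem_Icc x.1 x.2))]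
    refine lt_of_le_of_lt ?_ (half_lt_self hε)
    exact div_le_of_le_mul₀ (hρ.nonneg _ (abs_sub_mem_Icc x.1 x.2)) (half_pos hε).le h1
  · obtain ⟨r, hr, hFr⟩ := hF 1 one_pos
    have hne : 0 < |(u₀ : ℝ) - v₀| := abs_pos.2 (sub_ne_zero.2 fun h => huv (Subtype.ext h))
    have hpos : 0 < ρ |(u₀ : ℝ) - v₀| := hρ.pos _ ⟨hne, (abs_sub_mem_Icc _ _).2⟩
    set B : ℝ := ⌈1 / r⌉₊ * (1 * ρ 1) with hB
    refine Metric.equicontinuousAt_of_continuity_modulus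
      (fun x => (ρ |(x.1 : ℝ) - u₀| + ρ |(x.2 : ℝ) - v₀|) / ρ |(x.1 : ℝ) - x.2| +
        B * |(ρ |(x.1 : ℝ) - x.2|)⁻¹ - (ρ |(u₀ : ℝ) - v₀|)⁻¹|) ?_ _ ?_
    · have c1 : Continuous fun x : I × I => ρ |(x.1 : ℝ) - u₀| :=
        hρ.continuous_abs_sub continuous_fst continuous_const
      have c2 : Continuous fun x : I × I => ρ |(x.2 : ℝ) - v₀| :=
        hρ.continuous_abs_sub continuous_snd continuous_const
      have c3 : ContinuousAt (fun x : I × I => (ρ |(x.1 : ℝ) - u₀| + ρ |(x.2 : ℝ) - v₀|) /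
          ρ |(x.1 : ℝ) - x.2| + B * |(ρ |(x.1 : ℝ) - x.2|)⁻¹ - (ρ |(u₀ : ℝ) - v₀|)⁻¹|)
          (u₀, v₀) :=
        ((c1.add c2).continuousAt.div hcont.continuousAt hpos.ne').add
          (continuousAt_const.mul ((hcont.continuousAt.inv₀ hpos.ne').sub continuousAt_const).abs)
      have := c3.tendsto
      simpa [hρ.map_zero] using this
    · filter_upwards [hnear (fun x => |(x.1 : ℝ) - u₀|) (by fun_prop) (u₀, v₀) (by simp) hr,
        hnear (fun x => |(x.2 : ℝ) - v₀|) (by fun_prop) (u₀, v₀) (by simp) hr] with x h1 h2 i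
      have h1' := hFr i _ _ h1.le
      have h2' := hFr i _ _ h2.le
      have h3' := (hFr i).abs_sub_le hρ.monotoneOn zero_le_one hr u₀ v₀
      rw [one_mul] at h1' h2'
      have hx0 := hρ.nonneg _ (abs_sub_mem_Icc x.1 x.2)
      rw [dist_comm, Real.dist_eq]
      have e : holderLift ρ (F i) x - holderLift ρ (F i) (u₀, v₀) =
          ((F i x.1 - F i u₀) - (F i x.2 - F i v₀)) / ρ |(x.1 : ℝ) - x.2| +
          (F i u₀ - F i v₀) * ((ρ |(x.1 : ℝ) - x.2|)⁻¹ - (ρ |(u₀ : ℝ) - v₀|)⁻¹) := by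
        simp only [holderLift]
        ring
      rw [e]
      refine (abs_add_le _ _).trans (add_le_add ?_ ?_)
      · rw [abs_div, abs_of_nonneg hx0]
        exact div_le_div_of_nonneg_right ((abs_sub _ _).trans (add_le_add h1' h2')) hx0
      · rw [abs_mul]
        exact mul_le_mul_of_nonneg_right h3' (abs_nonneg _)

theorem exists_uniform_modulus_holderLift (hρ : IsModulus ρ) {p K t h : ℝ}
    (hρ₀ : PowerGauge ρ₀ p K) (hm : MuchLarger ρ ρ₀) (ht : 0 < t) (hh : 0 < h) {ε : ℝ}
    (hε : 0 < ε) : ∃ δ, 0 < δ ∧ ∀ f, LocalControl ρ₀ t h f → ∀ x y, dist x y < δ →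
      |holderLift ρ f x - holderLift ρ f y| ≤ ε := by
  have he : Equicontinuous fun f : {f // LocalControl ρ₀ t h f} => holderLift ρ f.1 := by
    refine equicontinuous_holderLift hρ fun ε hε => ?_
    obtain ⟨r, hr, H⟩ := LocalControl.exists_of_muchLarger hρ₀ hρ hm ht hh hε
    exact ⟨r, hr, fun f => H _ f.2⟩
  obtain ⟨δ, hδ, H⟩ := Metric.uniformEquicontinuous_iff.1
    (CompactSpace.uniformEquicontinuous_of_equicontinuous he) ε hε
  exact ⟨δ, hδ, fun f hf x y hxy => (H x y hxy ⟨f, hf⟩).le⟩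

theorem continuous_holderLift (hρ : IsModulus ρ) {f : I → ℝ}
    (hf : Tendsto (fun δ => localHolder ρ δ f) (𝓝[>] 0) (𝓝 0)) :
    Continuous (holderLift ρ f) := by
  have he : Equicontinuous fun _ : Unit => holderLift ρ f :=
    equicontinuous_holderLift hρ fun ε hε => by
      obtain ⟨r, hr, H⟩ := (tendsto_localHolder_zero_iff hρ).1 hf ε hε
      exact ⟨r, hr, fun _ => H⟩
  exact he.continuous ()

/-- The map `f ↦ holderLift ρ f` from `C^ρ_0` to the continuous functions on the square. -/
noncomputable def holderZeroLift (hρ : IsModulus ρ) : holderZero ρ →+ C(I × I, ℝ) where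
  toFun f := ⟨holderLift ρ f.1.toC, continuous_holderLift hρ f.2⟩
  map_zero' := by
    ext k
    change (0 : ℝ) + (0 - 0) / _ = 0
    simp
  map_add' f g := by
    ext k
    change (f.1.toC 0 + g.1.toC 0) + ((f.1.toC k.1 + g.1.toC k.1) - (f.1.toC k.2 + g.1.toC k.2)) / _
      = holderLift ρ f.1.toC k + holderLift ρ g.1.toC k
    simp only [holderLift]
    ring

theorem norm_holderZero (f : holderZero ρ) :
    ‖f‖ = ‖f.1.toC‖ + (holderSeminorm ρ f.1.toC).toReal := rfl

theorem isInducing_holderZeroLift (hρ : IsModulus ρ) : IsInducing (holderZeroLift hρ) := by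
  have hρ1 : 0 ≤ ρ 1 := hρ.nonneg 1 (by simp)
  have hL : LipschitzWith _ (holderZeroLift hρ) :=
    AddMonoidHomClass.lipschitz_of_bound (holderZeroLift hρ) 1 fun f => by
      rw [one_mul, norm_holderZero, ContinuousMap.norm_le _
        (add_nonneg (norm_nonneg _) ENNReal.toReal_nonneg)]
      intro k
      refine (abs_add_le _ _).trans (add_le_add (f.1.toC.norm_coe_le_norm 0) ?_)
      have h1 := abs_sub_le_of_holderSeminorm_le (f := f.1.toC) hρ ENNReal.toReal_nonneg
        (ENNReal.ofReal_toReal f.1.2).ge k.1 k.2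
      have h0 := hρ.nonneg _ (abs_sub_mem_Icc k.1 k.2)
      rw [abs_div, abs_of_nonneg h0]
      exact div_le_of_le_mul₀ h0 ENNReal.toReal_nonneg h1
  have hA : AntilipschitzWith (3 + 2 * ρ 1).toNNReal (holderZeroLift hρ) :=
    AddMonoidHomClass.antilipschitz_of_bound (holderZeroLift hρ) fun f => by
      rw [Real.coe_toNNReal _ (by positivity), norm_holderZero]
      set N := ‖holderZeroLift hρ f‖ with hN
      have hN0 : 0 ≤ N := norm_nonneg _
      have hval (k : I × I) : |holderLift ρ f.1.toC k| ≤ N :=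
        (holderZeroLift hρ f).norm_coe_le_norm k
      have h0 : |f.1.toC 0| ≤ N := by
        have := hval (0, 0)
        simpa [holderLift] using this
      have hinc (u v : I) : |f.1.toC u - f.1.toC v| ≤ 2 * N * ρ |(u : ℝ) - v| := by
        by_cases huv : u = v
        · simp [huv, hρ.map_zero]
        have hne : 0 < |(u : ℝ) - v| := abs_pos.2 (sub_ne_zero.2 fun h => huv (Subtype.ext h))
        have hpos : 0 < ρ |(u : ℝ) - v| := hρ.pos _ ⟨hne, (abs_sub_mem_Icc _ _).2⟩
        have e : f.1.toC u - f.1.toC v =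
            (holderLift ρ f.1.toC (u, v) - f.1.toC 0) * ρ |(u : ℝ) - v| := by
          simp only [holderLift, add_sub_cancel_left]
          rw [div_mul_cancel₀ _ hpos.ne']
        rw [e, abs_mul, abs_of_pos hpos]
        refine mul_le_mul_of_nonneg_right ((abs_sub _ _).trans ?_) hpos.le
        linarith [hval (u, v)]
      have h1 : (holderSeminorm ρ f.1.toC).toReal ≤ 2 * N :=
        ENNReal.toReal_le_of_le_ofReal (by positivity)
          (holderSeminorm_le_of hρ (by positivity) hinc)
      have h2 : ‖f.1.toC‖ ≤ N + 2 * N * ρ 1 := by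
        rw [ContinuousMap.norm_le _ (by positivity)]
        intro u
        have h3 := hinc u 0
        have h4 : ρ |(u : ℝ) - (0 : I)| ≤ ρ 1 :=
          hρ.monotoneOn (abs_sub_mem_Icc _ _) (by simp) (abs_sub_mem_Icc _ _).2
        have h5 := mul_le_mul_of_nonneg_left h4 (by positivity : 0 ≤ 2 * N)
        have h6 := abs_sub_abs_le_abs_sub (f.1.toC u) (f.1.toC 0)
        rw [Real.norm_eq_abs]
        linarith
      linarith
  exact (hA.isUniformInducing hL.uniformContinuous).isInducing
end

section
variable {Ω : ℕ → Type*} [∀ n, MeasurableSpace (Ω n)] {P : ∀ n, Measure (Ω n)}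
  [∀ n, IsProbabilityMeasure (P n)] {Ω' : Type*} [MeasurableSpace Ω'] {P' : Measure Ω'}
  {W : ∀ n, I → Ω n → ℝ} {V W' : I → Ω' → ℝ} {ρ ρ₀ : ℝ → ℝ}

theorem ae_exists_localControl {t : ℝ} {b : ℕ → ℝ≥0∞} (hb : Tendsto b atTop (𝓝 0))
    (h : ∀ j, P' {ω | ¬ LocalControl ρ₀ t ((1 / 2) ^ j) fun u => V u ω} ≤ b j) :
    ∀ᵐ ω ∂P', ∃ j : ℕ, LocalControl ρ₀ t ((1 / 2) ^ j) fun u => V u ω := by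
  refine le_antisymm (ge_of_tendsto' hb fun j => ?_) zero_le
  refine le_trans (measure_mono ?_) (h j)
  intro ω hω hg
  exact hω ⟨j, hg⟩

theorem ae_holderSeminorm_ne_top {p K t A : ℝ} (hρ₀ : PowerGauge ρ₀ p K) (hρ : IsModulus ρ)
    (ht : 0 ≤ t) (hA : 0 ≤ A) (hle : ∀ᶠ x in 𝓝[>] 0, ρ₀ x ≤ A * ρ x)
    (h : ∀ᵐ ω ∂P', ∃ j : ℕ, LocalControl ρ₀ t ((1 / 2) ^ j) fun u => V u ω) :
    ∀ᵐ ω ∂P', holderSeminorm ρ (fun u => V u ω) ≠ ∞ := by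
  filter_upwards [h] with ω ⟨j, hj⟩
  obtain ⟨M, hM⟩ := exists_holderSeminorm_le hρ₀ hρ ht
    (by positivity : (0 : ℝ) < (1 / 2) ^ j) hA hle
  exact ne_top_of_le_ne_top ENNReal.ofReal_ne_top (hM _ hj)

/-- An element of `C^ρ_0` from a continuous function with finite seminorm and vanishing local
modulus. -/
def holderZeroMk (f : C(I, ℝ)) (h : holderSeminorm ρ f ≠ ∞)
    (h0 : Tendsto (fun δ => localHolder ρ δ f) (𝓝[>] 0) (𝓝 0)) : holderZero ρ :=
  ⟨(⟨f, h⟩ : holderSubmodule ρ), h0⟩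

/-- A continuous process whose paths are almost surely in `C^ρ_0` gives a random element of this
space. -/
theorem IsContinuousProcess.exists_holderZero (hV : IsContinuousProcess V) (hρ : IsModulus ρ)
    (hfin : ∀ᵐ ω ∂P', holderSeminorm ρ (fun u => V u ω) ≠ ∞)
    (hzero : ∀ᵐ ω ∂P', Tendsto (fun δ => localHolder ρ δ fun u => V u ω) (𝓝[>] 0) (𝓝 0)) :
    ∃ X : Ω' → holderZero ρ, (∀ k, Measurable fun ω => holderZeroLift hρ (X ω) k) ∧
      ∀ᵐ ω ∂P', ∀ u, (X ω).1.toC u = V u ω := by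
  classical
  set N : Set Ω' := {ω | ¬ (holderSeminorm ρ (fun u => V u ω) ≠ ∞ ∧
    Tendsto (fun δ => localHolder ρ δ fun u => V u ω) (𝓝[>] 0) (𝓝 0))} with hN
  set G : Set Ω' := (toMeasurable P' N)ᶜ with hG
  have hGm : MeasurableSet G := (measurableSet_toMeasurable _ _).compl
  have hGN : ∀ ω ∈ G, holderSeminorm ρ (fun u => V u ω) ≠ ∞ ∧
      Tendsto (fun δ => localHolder ρ δ fun u => V u ω) (𝓝[>] 0) (𝓝 0) := fun ω hω => by
    by_contra hcon
    exact hω (subset_toMeasurable _ _ hcon)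
  have hGae : ∀ᵐ ω ∂P', ω ∈ G := by
    have h0 : P' N = 0 := hfin.and hzero
    rw [← measure_toMeasurable] at h0
    exact measure_eq_zero_iff_ae_notMem.1 h0
  set X : Ω' → holderZero ρ := fun ω => if h : ω ∈ G then
    holderZeroMk ⟨fun u => V u ω, hV.continuous ω⟩ (hGN ω h).1 (hGN ω h).2 else 0 with hX
  refine ⟨X, fun k => ?_, ?_⟩
  · have : (fun ω => holderZeroLift hρ (X ω) k) = fun ω =>
        if ω ∈ G then holderLift ρ (fun u => V u ω) k else 0 := by
      ext ω
      by_cases hω : ω ∈ G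
      · simp only [hX, hω, dif_pos, if_true]
        rfl
      · simp only [hX, hω, dif_neg, not_false_eq_true, if_false, map_zero]
        rfl
    rw [this]
    refine Measurable.ite hGm ?_ measurable_const
    have := hV.measurable
    unfold holderLift
    fun_prop
  · filter_upwards [hGae] with ω hω u
    simp only [hX, hω, dif_pos]
    rfl

variable [IsProbabilityMeasure P']

theorem TendstoFidi.le_liminf (h : TendstoFidi P P' W V) (S : Finset I) {U : Set (S → ℝ)}
    (hU : IsOpen U) : P' {ω | (fun u : S => V u ω) ∈ U} ≤
      liminf (fun n => P n {ω | (fun u : S => W n u ω) ∈ U}) atTop := by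
  have := ProbabilityMeasure.le_liminf_measure_open_of_tendsto (h S).tendsto hU
  simp only [ProbabilityMeasure.coe_mk] at this
  rw [Measure.map_apply_of_aemeasurable (h S).aemeasurable_limit hU.measurableSet] at this
  simp_rw [fun n => Measure.map_apply_of_aemeasurable ((h S).forall_aemeasurable n)
    hU.measurableSet] at this
  exact this

theorem TendstoFidi.congr (h : TendstoFidi P P' W W') (hV : ∀ u, V u =ᵐ[P'] W' u) :
    TendstoFidi P P' W V := fun S => by
  refine (h S).congr (fun n => EventuallyEq.rfl) ?_
  have : ∀ᵐ ω ∂P', ∀ u : S, V u ω = W' u ω := ae_all_iff.2 fun u => hV u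
  filter_upwards [this] with ω hω
  exact funext fun u => (hω u).symm

theorem TendstoFidi.incrTail (h : TendstoFidi P P' W V) {s κ K : ℝ}
    (hW : ∀ n, IncrTail (P n) (W n) ρ₀ s κ K) : IncrTail P' V ρ₀ s κ K := fun u v => by
  classical
  have hU : IsOpen {x : (({u, v} : Finset I)) → ℝ | s * ρ₀ |(u : ℝ) - v| <
      |x ⟨u, by simp⟩ - x ⟨v, by simp⟩|} := isOpen_lt continuous_const (by fun_prop)
  refine (h.le_liminf _ hU).trans ?_
  refine (liminf_le_liminf (Eventually.of_forall fun n => hW n u v)).trans ?_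
  rw [liminf_const]

theorem eventually_pow_le_radius {r : ℝ} (hr : 0 < r) :
    ∀ᶠ j : ℕ in atTop, ((1 : ℝ) / 2) ^ j ≤ r :=
  tendsto_half_pow.eventually_le_const hr

theorem tendstoHolderZero_of_localControl {p K t : ℝ} (hρ₀ : PowerGauge ρ₀ p K)
    (hρ : IsModulus ρ) (hm : MuchLarger ρ ρ₀) (ht : 0 < t)
    (hW : ∀ n, IsContinuousProcess (W n)) (hV : IsContinuousProcess V)
    (hfidi : TendstoFidi P P' W V) {b b' : ℕ → ℝ≥0∞} (hb0 : Tendsto b atTop (𝓝 0))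
    (hb : ∀ n j, P n {ω | ¬ LocalControl ρ₀ t ((1 / 2) ^ j) fun u => W n u ω} ≤ b j)
    (hb0' : Tendsto b' atTop (𝓝 0))
    (hb' : ∀ j, P' {ω | ¬ LocalControl ρ₀ t ((1 / 2) ^ j) fun u => V u ω} ≤ b' j) :
    TendstoHolderZero ρ P P' W V := by
  classical
  have hzero {f : I → ℝ} (hf : ∃ j : ℕ, LocalControl ρ₀ t ((1 / 2) ^ j) f) :
      Tendsto (fun δ => localHolder ρ δ f) (𝓝[>] 0) (𝓝 0) := by
    obtain ⟨j, hj⟩ := hf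
    refine (tendsto_localHolder_zero_iff hρ).2 fun ε hε => ?_
    obtain ⟨r, hr, H⟩ := LocalControl.exists_of_muchLarger hρ₀ hρ hm ht
      (by positivity : (0 : ℝ) < (1 / 2) ^ j) hε
    exact ⟨r, hr, H _ hj⟩
  have hle := hm.eventually_le hρ one_pos
  have hae (n : ℕ) := ae_exists_localControl hb0 (hb n)
  have hae' := ae_exists_localControl hb0' hb'
  choose X hXm hX using fun n => (hW n).exists_holderZero hρ
    (ae_holderSeminorm_ne_top hρ₀ hρ ht.le zero_le_one hle (hae n)) ((hae n).mono fun ω => hzero)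
  obtain ⟨X', hXm', hX'⟩ := hV.exists_holderZero hρ
    (ae_holderSeminorm_ne_top hρ₀ hρ ht.le zero_le_one hle hae') (hae'.mono fun ω => hzero)
  refine ⟨X, X', hX, hX', tendstoInDistribution_of_stochastic_equicontinuity
    (isInducing_holderZeroLift hρ) hXm hXm' (fun S U hU => ?_) fun ε hε => ?_⟩
  · set T : Finset I := insert 0 (S.image Prod.fst ∪ S.image Prod.snd) with hT
    have h1 (k : S) : k.1.1 ∈ T := Finset.mem_insert_of_mem
      (Finset.mem_union_left _ (Finset.mem_image_of_mem _ k.2))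
    have h2 (k : S) : k.1.2 ∈ T := Finset.mem_insert_of_mem
      (Finset.mem_union_right _ (Finset.mem_image_of_mem _ k.2))
    set g : (T → ℝ) → S → ℝ := fun w k => w ⟨0, Finset.mem_insert_self _ _⟩ +
      (w ⟨k.1.1, h1 k⟩ - w ⟨k.1.2, h2 k⟩) / ρ |(k.1.1 : ℝ) - k.1.2| with hg
    have hgc : Continuous g := by fun_prop
    have hfun {f : holderZero ρ} {w : I → ℝ} (hf : ∀ u, f.1.toC u = w u) :
        (fun k : S => holderZeroLift hρ f k) = g fun u : T => w u := by
      ext k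
      change holderLift ρ f.1.toC k = _
      simp only [holderLift, hf, hg]
    have key := hfidi.le_liminf T (hU.preimage hgc)
    refine le_trans (measure_mono_ae ?_) (key.trans
      (liminf_le_liminf (Eventually.of_forall fun n => measure_mono_ae ?_)))
    · filter_upwards [hX'] with ω hω hmem
      have hmem' : (fun k : S => holderZeroLift hρ (X' ω) k) ∈ U := hmem
      rw [hfun hω] at hmem'
      exact hmem'
    · filter_upwards [hX n] with ω hω hmem
      change (fun k : S => holderZeroLift hρ (X n ω) k) ∈ U
      rw [hfun hω]
      exact hmem
  · have hε' := ENNReal.ofReal_pos.2 hε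
    obtain ⟨j, hj, hj'⟩ :=
      ((hb0.eventually_le_const hε').and (hb0'.eventually_le_const hε')).exists
    obtain ⟨δ, hδ, H⟩ := exists_uniform_modulus_holderLift hρ hρ₀ hm ht
      (by positivity : (0 : ℝ) < (1 / 2) ^ j) hε
    have hfun {f : holderZero ρ} {w : I → ℝ} (hf : ∀ u, f.1.toC u = w u)
        (hw : LocalControl ρ₀ t ((1 / 2) ^ j) w) (x y : I × I) (hxy : dist x y < δ) :
        |holderZeroLift hρ f x - holderZeroLift hρ f y| ≤ ε := by
      have hfw : ((f.1.toC : C(I, ℝ)) : I → ℝ) = w := funext hf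
      change |holderLift ρ f.1.toC x - holderLift ρ f.1.toC y| ≤ ε
      rw [hfw]
      exact H w hw x y hxy
    refine ⟨δ, hδ, fun n => le_trans (measure_mono_ae ?_) ((hb n j).trans hj),
      le_trans (measure_mono_ae ?_) ((hb' j).trans hj')⟩
    · filter_upwards [hX n] with ω hω hnot hw
      exact hnot fun x y hxy => hfun hω hw x y hxy
    · filter_upwards [hX'] with ω hω hnot hw
      exact hnot fun x y hxy => hfun hω hw x y hxy

theorem PowerGauge.exists_uniform_modulus {p K t h : ℝ} (hρ₀ : PowerGauge ρ₀ p K) (ht : 0 ≤ t)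
    (hh : 0 < h) {ε : ℝ} (hε : 0 < ε) : ∃ δ, 0 < δ ∧ ∀ f, LocalControl ρ₀ t h f →
      ∀ x y : I, dist x y < δ → |f x - f y| ≤ ε := by
  have hc : Continuous fun z : ℝ => t * (K * ρ₀ 1 * z ^ p) :=
    continuous_const.mul (continuous_const.mul (Real.continuous_rpow_const hρ₀.p_pos.le))
  have h0 : Tendsto (fun z : ℝ => t * (K * ρ₀ 1 * z ^ p)) (𝓝 0) (𝓝 0) := by
    have := hc.tendsto 0
    simpa [Real.zero_rpow hρ₀.p_pos.ne'] using this
  obtain ⟨δ, hδ, H⟩ := Metric.eventually_nhds_iff.1 (h0.eventually_le_const hε)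
  refine ⟨min δ h, lt_min hδ hh, fun f hf x y hxy => ?_⟩
  rw [Subtype.dist_eq, Real.dist_eq] at hxy
  refine (hf x y (hxy.le.trans (min_le_right _ _))).trans
    (le_trans (mul_le_mul_of_nonneg_left (hρ₀.le_rpow (abs_sub_mem_Icc x y)) ht) (H ?_))
  rw [Real.dist_0_eq_abs, abs_abs]
  exact hxy.trans_le (min_le_left _ _)

/-- The paths of a continuous process as random elements of `C[0,1]`. -/
def IsContinuousProcess.path (hV : IsContinuousProcess V) (ω : Ω') : C(I, ℝ) :=
  ⟨fun u => V u ω, hV.continuous ω⟩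

theorem tendstoInDistribution_path [MeasurableSpace C(I, ℝ)] [BorelSpace C(I, ℝ)] {p K t : ℝ}
    (hρ₀ : PowerGauge ρ₀ p K) (ht : 0 ≤ t)
    (hW : ∀ n, IsContinuousProcess (W n)) (hV : IsContinuousProcess V)
    (hfidi : TendstoFidi P P' W V) {b b' : ℕ → ℝ≥0∞} (hb0 : Tendsto b atTop (𝓝 0))
    (hb : ∀ n j, P n {ω | ¬ LocalControl ρ₀ t ((1 / 2) ^ j) fun u => W n u ω} ≤ b j)
    (hb0' : Tendsto b' atTop (𝓝 0))
    (hb' : ∀ j, P' {ω | ¬ LocalControl ρ₀ t ((1 / 2) ^ j) fun u => V u ω} ≤ b' j) :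
    TendstoInDistribution (fun n => (hW n).path) atTop hV.path P P' := by
  refine tendstoInDistribution_of_stochastic_equicontinuity (Φ := id) IsInducing.id
    (fun n => (hW n).measurable) hV.measurable (fun S U hU => hfidi.le_liminf S hU) fun ε hε => ?_
  have hε' := ENNReal.ofReal_pos.2 hε
  obtain ⟨j, hj, hj'⟩ :=
    ((hb0.eventually_le_const hε').and (hb0'.eventually_le_const hε')).exists
  obtain ⟨δ, hδ, H⟩ := hρ₀.exists_uniform_modulus ht (by positivity : (0 : ℝ) < (1 / 2) ^ j) hε
  refine ⟨δ, hδ, fun n => le_trans (measure_mono ?_) ((hb n j).trans hj),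
    le_trans (measure_mono ?_) ((hb' j).trans hj')⟩
  · intro ω hω hw
    exact hω (H _ hw)
  · intro ω hω hw
    exact hω (H _ hw)

theorem isOpen_exists_increment_gt (ρ : ℝ → ℝ) (t : ℝ) :
    IsOpen {f : C(I, ℝ) | ∃ u v : I, t * ρ |(u : ℝ) - v| < |f u - f v|} := by
  simp only [Set.ofPred_exists]
  refine isOpen_iUnion fun u => isOpen_iUnion fun v => isOpen_lt continuous_const ?_
  exact ((continuous_eval_const u).sub (continuous_eval_const v)).abs

theorem isClosed_exists_increment_ge (hρ : IsModulus ρ) (t δ : ℝ) :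
    IsClosed {f : C(I, ℝ) | ∃ u v : I, δ ≤ |(u : ℝ) - v| ∧ t * ρ |(u : ℝ) - v| ≤ |f u - f v|} := by
  have hcl : IsClosed {x : (I × I) × C(I, ℝ) | δ ≤ |(x.1.1 : ℝ) - x.1.2| ∧
      t * ρ |(x.1.1 : ℝ) - x.1.2| ≤ |x.2 x.1.1 - x.2 x.1.2|} := by
    have c1 : Continuous fun x : (I × I) × C(I, ℝ) => |(x.1.1 : ℝ) - x.1.2| := by fun_prop
    have c2 : Continuous fun x : (I × I) × C(I, ℝ) => ρ |(x.1.1 : ℝ) - x.1.2| :=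
      hρ.continuous_abs_sub (f := fun x : (I × I) × C(I, ℝ) => x.1.1) (by fun_prop) (by fun_prop)
    have c3 : Continuous fun x : (I × I) × C(I, ℝ) => |x.2 x.1.1 - x.2 x.1.2| := by fun_prop
    exact (isClosed_le continuous_const c1).inter (isClosed_le (continuous_const.mul c2) c3)
  convert isClosedMap_snd_of_compactSpace _ hcl using 1
  ext f
  simp only [Set.mem_ofPred_eq, Set.mem_image, Prod.exists, exists_eq_right]

theorem lt_holderSeminorm_iff (hρ : IsModulus ρ) {t : ℝ} (ht : 0 ≤ t) {f : I → ℝ} :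
    ENNReal.ofReal t < holderSeminorm ρ f ↔ ∃ u v : I, t * ρ |(u : ℝ) - v| < |f u - f v| := by
  simp only [holderSeminorm, lt_iSup_iff]
  exact exists₂_congr fun u v => lt_weightedIncr_iff (hρ.nonneg _ (abs_sub_mem_Icc u v)) ht

theorem lt_toReal_holderSeminorm_iff (hρ : IsModulus ρ) {t : ℝ} (ht : 0 ≤ t) {f : I → ℝ}
    (hf : holderSeminorm ρ f ≠ ∞) : t < (holderSeminorm ρ f).toReal ↔
      ∃ u v : I, t * ρ |(u : ℝ) - v| < |f u - f v| := by
  rw [← lt_holderSeminorm_iff hρ ht, ENNReal.ofReal_lt_iff_lt_toReal ht hf]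

/-- At a continuity point of the distribution function, the tail is insensitive to the boundary. -/
theorem measure_le_le_measure_lt_of_continuousAt {X : Ω' → ℝ} {t r : ℝ} (hr : r < t)
    (hm : ∀ s, r < s → NullMeasurableSet {ω | X ω ≤ s} P')
    (hc : ContinuousAt (fun s => P' {ω | X ω ≤ s}) t) :
    P' {ω | t ≤ X ω} ≤ P' {ω | t < X ω} := by
  have hcompl (s : ℝ) (hs : r < s) : P' {ω | s < X ω} = 1 - P' {ω | X ω ≤ s} := by
    rw [← prob_compl_eq_one_sub₀ (hm s hs)]
    congr 1
    ext ω
    simp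
  rw [hcompl t hr]
  have hlim : Tendsto (fun s => 1 - P' {ω | X ω ≤ s}) (𝓝[<] t) (𝓝 (1 - P' {ω | X ω ≤ t})) :=
    ENNReal.Tendsto.sub tendsto_const_nhds (hc.tendsto.mono_left nhdsWithin_le_nhds)
      (Or.inl ENNReal.one_ne_top)
  refine ge_of_tendsto hlim ?_
  filter_upwards [Ioo_mem_nhdsLT hr] with s hs
  rw [← hcompl s hs.1]
  exact measure_mono fun ω hω => lt_of_lt_of_le hs.2 hω

theorem tendstoBeyond_holderSeminorm {p K C : ℝ} (hC : 0 < C) (hρ₀ : PowerGauge ρ₀ p K)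
    (hρ : IsModulus ρ) (hratio : Tendsto (fun h => ρ h / ρ₀ h) (𝓝[>] 0) (𝓝 1))
    (hW : ∀ n, IsContinuousProcess (W n)) (hV : IsContinuousProcess V)
    (hfidi : TendstoFidi P P' W V)
    (hb : ∀ t, C < t → ∃ b : ℕ → ℝ≥0∞, Tendsto b atTop (𝓝 0) ∧
      ∀ n j, P n {ω | ¬ LocalControl ρ₀ t ((1 / 2) ^ j) fun u => W n u ω} ≤ b j)
    (hb' : ∀ t, C < t → ∃ b : ℕ → ℝ≥0∞, Tendsto b atTop (𝓝 0) ∧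
      ∀ j, P' {ω | ¬ LocalControl ρ₀ t ((1 / 2) ^ j) fun u => V u ω} ≤ b j)
    (hfin : ∀ n, ∀ᵐ ω ∂(P n), holderSeminorm ρ (fun u => W n u ω) ≠ ∞)
    (hfin' : ∀ᵐ ω ∂P', holderSeminorm ρ (fun u => V u ω) ≠ ∞) :
    TendstoBeyond C P P' (fun n ω => (holderSeminorm ρ (fun u => W n u ω)).toReal)
      (fun ω => (holderSeminorm ρ (fun u => V u ω)).toReal) := by
  intro t hCt hcont
  borelize C(I, ℝ)
  have ht : 0 < t := hC.trans hCt
  set s := (C + t) / 2 with hs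
  have hCs : C < s := by linarith
  have hst : s < t := by linarith
  have hs0 : 0 < s := hC.trans hCs
  obtain ⟨b, hb0, hb⟩ := hb s hCs
  obtain ⟨b', hb0', hb'⟩ := hb' s hCs
  have hconv := tendstoInDistribution_path hρ₀ hs0.le hW hV hfidi hb0 hb hb0' hb'
  have hmW (n : ℕ) : AEMeasurable (hW n).path (P n) := hconv.forall_aemeasurable n
  have hmV : AEMeasurable hV.path P' := hconv.aemeasurable_limit
  have hO := isOpen_exists_increment_gt ρ t
  refine tendsto_of_le_liminf_of_limsup_le ?_ ?_ (by isBoundedDefault) (by isBoundedDefault)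
  · have h1 := ProbabilityMeasure.le_liminf_measure_open_of_tendsto hconv.tendsto hO
    simp only [ProbabilityMeasure.coe_mk] at h1
    rw [Measure.map_apply_of_aemeasurable hmV hO.measurableSet] at h1
    simp_rw [fun n => Measure.map_apply_of_aemeasurable (hmW n) hO.measurableSet] at h1
    refine le_trans (measure_mono_ae ?_) (h1.trans
      (liminf_le_liminf (Eventually.of_forall fun n => measure_mono_ae ?_)))
    · filter_upwards [hfin'] with ω hω hlt
      exact (lt_toReal_holderSeminorm_iff hρ ht.le hω).1 hlt
    · filter_upwards [hfin n] with ω hω hlt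
      exact (lt_toReal_holderSeminorm_iff hρ ht.le hω).2 hlt
  · have hA : 1 < t / s := (one_lt_div hs0).2 hst
    obtain ⟨r, hr0, -, hr⟩ := exists_radius_of_eventually one_pos
      (eventually_le_mul_of_tendsto_div_one hρ₀.nonneg hratio hA)
    have hge : P' {ω | t ≤ (holderSeminorm ρ fun u => V u ω).toReal} ≤
        P' {ω | t < (holderSeminorm ρ fun u => V u ω).toReal} := by
      refine measure_le_le_measure_lt_of_continuousAt ht (fun x hx => ?_) hcont
      have h1 : NullMeasurableSet (hV.path ⁻¹' {f : C(I, ℝ) | ∃ u v : I,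
          x * ρ |(u : ℝ) - v| < |f u - f v|}ᶜ) P' :=
        hmV.nullMeasurableSet_preimage
          (isOpen_exists_increment_gt ρ x).measurableSet.compl
      refine h1.congr ?_
      filter_upwards [hfin'] with ω hω
      refine propext ?_
      have := not_congr (lt_toReal_holderSeminorm_iff hρ hx.le hω)
      rw [not_lt] at this
      exact this.symm
    have hlim := hb0.const_add (P' {ω | t < (holderSeminorm ρ fun u => V u ω).toReal})
    rw [add_zero] at hlim
    refine ge_of_tendsto hlim ?_
    filter_upwards [eventually_pow_le_radius hr0] with j hj
    set F : Set C(I, ℝ) := {f | ∃ u v : I, (1 / 2 : ℝ) ^ j ≤ |(u : ℝ) - v| ∧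
      t * ρ |(u : ℝ) - v| ≤ |f u - f v|} with hF
    have hFc : IsClosed F := isClosed_exists_increment_ge hρ t _
    have h1 := ProbabilityMeasure.limsup_measure_closed_le_of_tendsto hconv.tendsto hFc
    simp only [ProbabilityMeasure.coe_mk] at h1
    rw [Measure.map_apply_of_aemeasurable hmV hFc.measurableSet] at h1
    simp_rw [fun n => Measure.map_apply_of_aemeasurable (hmW n) hFc.measurableSet] at h1
    have h2 : P' (hV.path ⁻¹' F) ≤ P' {ω | t < (holderSeminorm ρ fun u => V u ω).toReal} := by
      refine le_trans (measure_mono_ae ?_) hge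
      filter_upwards [hfin'] with ω hω hmem
      obtain ⟨u, v, huv, hle⟩ : ∃ u v : I, (1 / 2 : ℝ) ^ j ≤ |(u : ℝ) - v| ∧
        t * ρ |(u : ℝ) - v| ≤ |V u ω - V v ω| := hmem
      have hpos : 0 < |(u : ℝ) - v| := lt_of_lt_of_le (by positivity) huv
      have hρpos := hρ.pos _ ⟨hpos, (abs_sub_mem_Icc u v).2⟩
      have h3 := abs_sub_le_of_holderSeminorm_le (f := fun u => V u ω) hρ ENNReal.toReal_nonneg
        (ENNReal.ofReal_toReal hω).ge u v
      exact le_of_mul_le_mul_right (hle.trans h3) hρpos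
    have h3 (n : ℕ) : P n {ω | t < (holderSeminorm ρ fun u => W n u ω).toReal} ≤
        P n ((hW n).path ⁻¹' F) + b j := by
      refine le_trans (measure_mono_ae ?_)
        ((measure_union_le _ _).trans (add_le_add_right (hb n j) _))
      filter_upwards [hfin n] with ω hω hlt
      obtain ⟨u, v, huv⟩ := (lt_toReal_holderSeminorm_iff hρ ht.le hω).1 hlt
      rcases le_total ((1 / 2 : ℝ) ^ j) |(u : ℝ) - v| with hd | hd
      · exact Or.inl ⟨u, v, hd, huv.le⟩
      · right
        intro hctl
        have h4 := hctl.of_le hρ₀.map_zero hρ.map_zero hs0.le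
          (fun x hx => hr x ⟨hx.1, hx.2.trans hj⟩) u v hd
        rw [mul_div_cancel₀ _ hs0.ne'] at h4
        exact absurd h4 (not_le.2 huv)
    calc limsup (fun n => P n {ω | t < (holderSeminorm ρ fun u => W n u ω).toReal}) atTop
        ≤ limsup (fun n => P n ((hW n).path ⁻¹' F) + b j) atTop :=
          limsup_le_limsup (Eventually.of_forall h3)
      _ = limsup (fun n => P n ((hW n).path ⁻¹' F)) atTop + b j :=
          limsup_add_const atTop _ _ (by isBoundedDefault) (by isBoundedDefault)
      _ ≤ _ := add_le_add_left (h1.trans h2) _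
end

theorem theorem1
    {Ω : ℕ → Type*} [∀ n, MeasurableSpace (Ω n)]
    (P : ∀ n, Measure (Ω n)) [∀ n, IsProbabilityMeasure (P n)]
    (W : ∀ n, I → Ω n → ℝ) (hW : ∀ n, IsContinuousProcess (W n))
    (ρ₀ : ℝ → ℝ) (hρ₀_nonneg : ∀ h ∈ Set.Icc (0 : ℝ) 1, 0 ≤ ρ₀ h)
    (hρ₀_mono : MonotoneOn ρ₀ (Set.Icc 0 1)) (hρ₀_zero : ρ₀ 0 = 0)
    (C : ℝ) (hC : 0 < C)
    (hT : ∀ t, C < t → ∃ κ : ℝ, 1 < κ ∧ ∃ K : ℝ, 0 < K ∧ ∀ (n : ℕ) (u v : I),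
      P n {ω | ENNReal.ofReal t < weightedIncr ρ₀ (fun x => W n x ω) u v} ≤
        ENNReal.ofReal (K * |(u : ℝ) - v| ^ κ))
    (hR : ∃ p : ℝ, 0 < p ∧ ∃ K' : ℝ, 0 < K' ∧
      ∀ h ∈ Set.Icc (0 : ℝ) 1, ∀ z ∈ Set.Icc (0 : ℝ) 1, ρ₀ (z * h) ≤ K' * z ^ p * ρ₀ h) :
    -- the local modulus, uniformly in `n`
    (∀ t, C < t → Tendsto
      (fun h => ⨆ n, P n {ω | ENNReal.ofReal t < localHolder ρ₀ h (fun x => W n x ω)})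
      (𝓝[>] 0) (𝓝 0)) ∧
    -- stochastic boundedness
    (∀ ρ, IsModulus ρ → MuchLarger ρ ρ₀ → ∀ ε : ℝ≥0∞, 0 < ε → ∃ M : ℝ, ∀ n,
      P n {ω | ENNReal.ofReal M < holderSeminorm ρ (fun x => W n x ω)} ≤ ε) ∧
    -- weak limits
    (∀ (Ω' : Type*) [MeasurableSpace Ω'] (P' : Measure Ω') [IsProbabilityMeasure P']
      (W' : I → Ω' → ℝ), (∀ u, Measurable (W' u)) → TendstoFidi P P' W W' →
      (∃ V : I → Ω' → ℝ, IsContinuousProcess V ∧ ∀ u, V u =ᵐ[P'] W' u) ∧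
      ∀ V : I → Ω' → ℝ, IsContinuousProcess V → (∀ u, V u =ᵐ[P'] W' u) →
        (∀ ρ, IsModulus ρ → MuchLarger ρ ρ₀ → TendstoHolderZero ρ P P' W V) ∧
        (∀ ρ, IsModulus ρ → Tendsto (fun h => ρ h / ρ₀ h) (𝓝[>] 0) (𝓝 1) →
          (∀ n, ∀ᵐ ω ∂(P n), holderSeminorm ρ (fun x => W n x ω) ≠ ∞) ∧
          (∀ᵐ ω ∂P', holderSeminorm ρ (fun x => V x ω) ≠ ∞) ∧
          TendstoBeyond C P P' (fun n ω => (holderSeminorm ρ (fun x => W n x ω)).toReal)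
            (fun ω => (holderSeminorm ρ (fun x => V x ω)).toReal))) := by
  obtain ⟨p, hp, K', hK', hscale⟩ := hR
  have hρ₀ : PowerGauge ρ₀ p K' :=
    ⟨hρ₀_nonneg, hρ₀_mono, hρ₀_zero, hp, hK', hscale⟩
  have htail : ∀ s, C < s → ∃ κ : ℝ, 1 < κ ∧ ∃ K : ℝ, 0 < K ∧
      ∀ n, IncrTail (P n) (W n) ρ₀ s κ K := by
    intro s hs
    obtain ⟨κ, hκ, K, hK, h⟩ := hT s hs
    refine ⟨κ, hκ, K, hK, fun n u v => le_trans (le_of_eq ?_) (h n u v)⟩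
    congr 1
    ext ω
    exact (lt_weightedIncr_iff (f := fun x => W n x ω) (hρ₀.nonneg _ (abs_sub_mem_Icc u v))
      (hC.trans hs).le).symm
  have hctl : ∀ t, C < t → ∃ b : ℕ → ℝ≥0∞, Tendsto b atTop (𝓝 0) ∧
      ∀ n j, P n {ω | ¬ LocalControl ρ₀ t ((1 / 2) ^ j) fun u => W n u ω} ≤ b j := by
    intro t ht
    obtain ⟨κ, hκ, K, hK, h⟩ := htail ((C + t) / 2) (by linarith)
    obtain ⟨b, hb0, hb⟩ := exists_localControl_bound hρ₀ (by linarith : 0 ≤ (C + t) / 2)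
      (by linarith : (C + t) / 2 < t) hκ hK.le
    exact ⟨b, hb0, fun n j => hb (P n) (W n) (hW n).continuous (h n) j⟩
  refine ⟨fun t ht => ?_, fun ρ hρ hm ε hε => ?_, ?_⟩
  · obtain ⟨b, hb0, hb⟩ := hctl t ht
    rw [ENNReal.tendsto_nhds_zero]
    intro ε hε
    obtain ⟨j, hj⟩ := (hb0.eventually_le_const hε).exists
    filter_upwards [Ioc_mem_nhdsGT (by positivity : (0 : ℝ) < (1 / 2) ^ j)] with h hh
    refine iSup_le fun n => le_trans (measure_mono ?_) ((hb n j).trans hj)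
    intro ω hω hloc
    exact absurd ((localHolder_le_iff hρ₀.nonneg (hC.trans ht).le).2 (hloc.anti hh.2))
      (not_le.2 hω)
  · obtain ⟨b, hb0, hb⟩ := hctl (C + 1) (by linarith)
    obtain ⟨j, hj⟩ := (hb0.eventually_le_const hε).exists
    obtain ⟨M, hM⟩ := exists_holderSeminorm_le hρ₀ hρ (by linarith : 0 ≤ C + 1)
      (by positivity : (0 : ℝ) < (1 / 2) ^ j) zero_le_one (hm.eventually_le hρ one_pos)
    refine ⟨M, fun n => le_trans (measure_mono ?_) ((hb n j).trans hj)⟩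
    intro ω hω hloc
    exact absurd (hM _ hloc) (not_le.2 hω)
  · intro Ω' _ P' _ W' hW' hfidi
    refine ⟨?_, fun V hV hVW => ?_⟩
    · obtain ⟨κ, hκ, K, hK, h⟩ := htail (C + 1) (by linarith)
      exact (hfidi.incrTail h).exists_modification hW' hρ₀ (by linarith) hκ hK.le
    have hfidiV := hfidi.congr hVW
    have hctl' : ∀ t, C < t → ∃ b : ℕ → ℝ≥0∞, Tendsto b atTop (𝓝 0) ∧
        ∀ j, P' {ω | ¬ LocalControl ρ₀ t ((1 / 2) ^ j) fun u => V u ω} ≤ b j := by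
      intro t ht
      obtain ⟨κ, hκ, K, hK, h⟩ := htail ((C + t) / 2) (by linarith)
      obtain ⟨b, hb0, hb⟩ := exists_localControl_bound hρ₀ (by linarith : 0 ≤ (C + t) / 2)
        (by linarith : (C + t) / 2 < t) hκ hK.le
      exact ⟨b, hb0, hb P' V hV.continuous (hfidiV.incrTail h)⟩
    obtain ⟨b, hb0, hb⟩ := hctl (C + 1) (by linarith)
    obtain ⟨b', hb0', hb'⟩ := hctl' (C + 1) (by linarith)
    have hC1 : 0 < C + 1 := by linarith
    refine ⟨fun ρ hρ hm => tendstoHolderZero_of_localControl hρ₀ hρ hm hC1 hW hV hfidiV hb0 hb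
      hb0' hb', fun ρ hρ hratio => ?_⟩
    have hle := eventually_le_mul_of_tendsto_div_one hρ₀.nonneg hratio one_lt_two
    have hfin (n : ℕ) := ae_holderSeminorm_ne_top hρ₀ hρ hC1.le zero_le_two hle
      (ae_exists_localControl hb0 (hb n))
    have hfin' := ae_holderSeminorm_ne_top hρ₀ hρ hC1.le zero_le_two hle
      (ae_exists_localControl hb0' hb')
    exact ⟨hfin, hfin', tendstoBeyond_holderSeminorm hC hρ₀ hρ hratio hW hV hfidiV hctl hctl'
      hfin hfin'⟩
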